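/- Let $G$ be a compact Lie group with Lie algebra $\mathfrak g$, equipped with an $\operatorname{Ad}$-invariant inner product "$\cdot$", and let $\theta^L,\theta^R\in\Omega^1(G,\mathfrak g)$ be the left- and right-invariant Maurer–Cartan forms. For a $G$-manifold $M$ and $\xi\in\mathfrak g$ put $\xi_M(m)=\frac{d}{dt}\big|_{t=0}\exp(-t\xi).m$. A group valued Hamiltonian $G$-manifold is a triple $(M,\omega,\Phi)$ consisting of a $G$-manifold $M$, a $G$-invariant 2-form $\omega$ and a smooth map $\Phi:M\to G$, equivariant for the conjugation action on $G$, such that $$d\omega=\Phi^*\eta,\quad \eta=\tfrac1{12}\theta^L\cdot[\theta^L,\theta^L],\qquad \iota(\xi_M)\omega=\tfrac12\Phi^*(\theta^L+\theta^R)\cdot\xi\quad(\xi\in\mathfrak g),$$ and $\ker\omega_m=\{\xi_M(m)\mid(\operatorname{Ad}_{\Phi(m)}+1)\xi=0\}$ for all $m\in M$. Let $\operatorname{Cl}(\mathfrak g)$ be the Clifford algebra in which $x_ix_j+x_jx_i=\delta_{ij}$ for the generators $x_i$ given by an orthonormal basis $e_i$ of $\mathfrak g$, let $\alpha$ be its parity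 operator, and let $\operatorname{Pin}(\mathfrak g)\subset\operatorname{Cl}(\mathfrak g)^\times$ be the subgroup generated by the $\xi\in\mathfrak g$ with $\xi\cdot\xi=2$. It acts on $\mathfrak g\subset\operatorname{Cl}(\mathfrak g)$ by $y\mapsto\alpha(x)yx^{-1}$. Let $\tau:G\to\operatorname{Pin}(\mathfrak g)$ be a continuous group homomorphism that lifts the adjoint action, i.e. $\alpha(\tau(g))\,\xi\,\tau(g)^{-1}=\operatorname{Ad}_g\xi$ for all $g\in G$, $\xi\in\mathfrak g$. Let $\sigma:\operatorname{Cl}(\mathfrak g)\to\wedge\mathfrak g$ be the symbol map, $x_{i_1}\cdots x_{i_s}\mapsto y_{i_1}\cdots y_{i_s}$ for $i_1<\dots<i_s$ (with $y_i$ the generators of $\wedge\mathfrak g$), and let $\mathcal T\in\Omega(G)$ be the form whose value at $g$ is obtained from $\sigma(\tau(g))$ by replacing each $y_i$ with $\frac12(\theta^R\cdot e_i)_g$. Then for every group valued Hamiltonian $G$-manifold $(M,\omega,\Phi)$ (with $M$ of pure dimension), the top degree part $\Gamma_{[\dim M]}$ of the differential form $\Gamma=\exp(\omega)\,\Phi^*\mathcal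 T$ is a volume form on $M$, i.e. it is smooth and vanishes nowhere. At every point $m$ where $\omega$ is non-degenerate, $$\Gamma_{[\dim M]}=\pm\,\frac{\exp(\omega)_{[\dim M]}}{\big|\det\big(\frac{1+\operatorname{Ad}_{\Phi}}{2}\big)\big|^{1/2}},$$ where the sign depends on the choice of the lift $\tau$, and at $m$ it is a function of $\Phi(m)\in G$ only. -/

import Mathlib

open scoped Manifold ContDiff

noncomputable section

/-! ### Exterior algebra of a cotangent space

A mixed-degree form at a point is an element of the exterior algebra `⋀ V*` of the dual of the
tangent space `V`; a homogeneous form of degree `k` is an alternating map on `V`, with the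
convention `(α₁ ∧ ⋯ ∧ αₖ)(v₁, …, vₖ) = det (αⱼ (vᵢ))`. -/

section ExteriorForms

variable {V : Type*} [AddCommGroup V] [Module ℝ V]

/-- The component of degree `k` of `x ∈ ⋀ V*`, as an alternating `k`-linear map on `V`. -/
def formPartAlg (k : ℕ) (x : ExteriorAlgebra ℝ (Module.Dual ℝ V)) : V [⋀^Fin k]→ₗ[ℝ] ℝ :=
  (exteriorPower.pairingDual ℝ V k
    (DirectSum.decompose (fun i : ℕ => ⋀[ℝ]^i (Module.Dual ℝ V)) x k)).compAlternatingMap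
    (exteriorPower.ιMulti ℝ k)

theorem AlternatingMap.continuous_of_finiteDim [FiniteDimensional ℝ V] [TopologicalSpace V]
    [IsTopologicalAddGroup V] [ContinuousSMul ℝ V] [T2Space V] {k : ℕ}
    (f : V [⋀^Fin k]→ₗ[ℝ] ℝ) : Continuous f := by
  classical
  let b := Module.finBasis ℝ V
  have h : ∀ v : Fin k → V, f v = ∑ r : Fin k → Fin (Module.finrank ℝ V),
      (∏ i, b.repr (v i) (r i)) • f (fun i => b (r i)) := by
    intro v
    have hv : v = fun i => ∑ j, b.repr (v i) j • b j := by
      funext i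
      exact (b.sum_repr (v i)).symm
    conv_lhs => rw [hv]
    have h1 := f.toMultilinearMap.map_sum (fun i j => b.repr (v i) j • b j)
    simp only [AlternatingMap.coe_multilinearMap] at h1
    rw [h1]
    refine Finset.sum_congr rfl fun r _ => ?_
    exact f.toMultilinearMap.map_smul_univ (fun i => b.repr (v i) (r i)) (fun i => b (r i))
  have h' : (f : (Fin k → V) → ℝ) = fun v => ∑ r : Fin k → Fin (Module.finrank ℝ V),
      (∏ i, b.repr (v i) (r i)) • f (fun i => b (r i)) := funext h
  rw [h']
  simp only [smul_eq_mul]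
  refine continuous_finsetSum _ fun r _ => Continuous.mul ?_ continuous_const
  refine continuous_finsetProd _ fun i _ => ?_
  exact (LinearMap.continuous_of_finiteDimensional (b.coord (r i))).comp (continuous_apply i)

/-- `formPartAlg` as a continuous alternating map. -/
def formPart [FiniteDimensional ℝ V] [TopologicalSpace V] [IsTopologicalAddGroup V]
    [ContinuousSMul ℝ V] [T2Space V] (k : ℕ) (x : ExteriorAlgebra ℝ (Module.Dual ℝ V)) :
    V [⋀^Fin k]→L[ℝ] ℝ :=
  { formPartAlg k x with cont := AlternatingMap.continuous_of_finiteDim (formPartAlg k x) }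

/-- The element `∑_{i<j} β(bᵢ, bⱼ) bⁱ ∧ bʲ = ½ ∑_{i,j} β(bᵢ, bⱼ) bⁱ ∧ bʲ` of `⋀ V*`
given by a 2-form `β` (it does not depend on the basis `b`). -/
def twoFormElem [FiniteDimensional ℝ V] [TopologicalSpace V] (β : V [⋀^Fin 2]→L[ℝ] ℝ) :
    ExteriorAlgebra ℝ (Module.Dual ℝ V) :=
  (1 / 2 : ℝ) • ∑ i, ∑ j,
    β ![Module.finBasis ℝ V i, Module.finBasis ℝ V j] •
      (ExteriorAlgebra.ι ℝ ((Module.finBasis ℝ V).coord i) *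
        ExteriorAlgebra.ι ℝ ((Module.finBasis ℝ V).coord j))

/-- `exp(β) = ∑ₖ βᵏ / k!` in `⋀ V*`; the powers with `k > dim V` vanish. -/
def expTwoForm [FiniteDimensional ℝ V] [TopologicalSpace V] (β : V [⋀^Fin 2]→L[ℝ] ℝ) :
    ExteriorAlgebra ℝ (Module.Dual ℝ V) :=
  ∑ k ∈ Finset.range (Module.finrank ℝ V + 1), ((k.factorial : ℝ)⁻¹) • twoFormElem β ^ k

end ExteriorForms

/-! ### Differential forms on manifolds without boundary -/

section Forms

variable {E : Type*} [NormedAddCommGroup E] [NormedSpace ℝ E]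
  {M : Type*} [TopologicalSpace M] [ChartedSpace E M]

instance instFiniteDimensionalTangent [h : FiniteDimensional ℝ E] (x : M) :
    FiniteDimensional ℝ (TangentSpace 𝓘(ℝ, E) x) := h

instance instT2SpaceTangent (x : M) : T2Space (TangentSpace 𝓘(ℝ, E) x) :=
  inferInstanceAs (T2Space E)

variable (E M) in
/-- Not necessarily smooth differential forms of degree `k` on `M`. -/
abbrev DiffForm (k : ℕ) : Type _ := ∀ x : M, TangentSpace 𝓘(ℝ, E) x [⋀^Fin k]→L[ℝ] ℝ

/-- The pull-back of `β` under the inverse of the preferred chart at `x`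
(meaningful on the target of that chart). -/
def DiffForm.inChart {k : ℕ} (β : DiffForm E M k) (x : M) : E → E [⋀^Fin k]→L[ℝ] ℝ := fun y =>
  (β ((extChartAt 𝓘(ℝ, E) x).symm y)).compContinuousLinearMap
    (mfderiv 𝓘(ℝ, E) 𝓘(ℝ, E) (extChartAt 𝓘(ℝ, E) x).symm y)

/-- A form is smooth if its coefficient functions in charts covering `M` are smooth. -/
def DiffForm.IsSmooth {k : ℕ} (β : DiffForm E M k) : Prop :=
  ∀ (x : M) (v : Fin k → E),
    ContDiffOn ℝ ∞ (fun y => β.inChart x y v) (extChartAt 𝓘(ℝ, E) x).target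

/-- The exterior derivative at `x`, computed in the preferred chart at `x`. -/
def DiffForm.d {k : ℕ} (β : DiffForm E M k) : DiffForm E M (k + 1) := fun x =>
  (extDeriv (β.inChart x) (extChartAt 𝓘(ℝ, E) x x)).compContinuousLinearMap
    (mfderiv 𝓘(ℝ, E) 𝓘(ℝ, E) (extChartAt 𝓘(ℝ, E) x) x)

/-- A volume form: a smooth nowhere vanishing form of top degree. -/
def DiffForm.IsVolumeForm (Ω : DiffForm E M (Module.finrank ℝ E)) : Prop :=
  Ω.IsSmooth ∧ ∀ x, Ω x ≠ 0

end Forms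

/-! ### Lie groups: adjoint action, Maurer-Cartan forms, canonical 3-form -/

section LieGroups

variable {EG : Type*} [NormedAddCommGroup EG] [NormedSpace ℝ EG]
  {G : Type*} [TopologicalSpace G] [ChartedSpace EG G] [Group G]

/-- The adjoint action of `g`: the derivative at `1` of `h ↦ g h g⁻¹`. -/
def adjointAction (g : G) : GroupLieAlgebra 𝓘(ℝ, EG) G →L[ℝ] GroupLieAlgebra 𝓘(ℝ, EG) G :=
  mfderiv 𝓘(ℝ, EG) 𝓘(ℝ, EG) (fun h : G => g * h * g⁻¹) 1

/-- The left-invariant Maurer-Cartan form at `g`: the derivative at `g` of `h ↦ g⁻¹ h`. -/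
def thetaL (g : G) : TangentSpace 𝓘(ℝ, EG) g →L[ℝ] GroupLieAlgebra 𝓘(ℝ, EG) G :=
  mfderiv 𝓘(ℝ, EG) 𝓘(ℝ, EG) (fun h : G => g⁻¹ * h) g

/-- The right-invariant Maurer-Cartan form at `g`: the derivative at `g` of `h ↦ h g⁻¹`. -/
def thetaR (g : G) : TangentSpace 𝓘(ℝ, EG) g →L[ℝ] GroupLieAlgebra 𝓘(ℝ, EG) G :=
  mfderiv 𝓘(ℝ, EG) 𝓘(ℝ, EG) (fun h : G => h * g⁻¹) g

variable (EG G) in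
/-- An inner product on the Lie algebra that is invariant under the adjoint action. -/
structure InvariantInnerProduct where
  form : LinearMap.BilinForm ℝ (GroupLieAlgebra 𝓘(ℝ, EG) G)
  symm : ∀ ξ ζ, form ξ ζ = form ζ ξ
  pos : ∀ ξ, ξ ≠ 0 → 0 < form ξ ξ
  invariant : ∀ (g : G) (ξ ζ), form (adjointAction g ξ) (adjointAction g ζ) = form ξ ζ

namespace InvariantInnerProduct

variable (B : InvariantInnerProduct EG G)

/-- The canonical 3-form `η = (1/12) θᴸ · [θᴸ, θᴸ]`, where `[θᴸ, θᴸ](v, w) = 2 [θᴸ v, θᴸ w]`, and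
the wedge product with a 1-form is the cyclic sum. -/
def eta (g : G) (u v w : TangentSpace 𝓘(ℝ, EG) g) : ℝ :=
  (1 / 12) * (B.form (thetaL g u) ((2 : ℝ) • ⁅thetaL g v, thetaL g w⁆) +
    B.form (thetaL g v) ((2 : ℝ) • ⁅thetaL g w, thetaL g u⁆) +
    B.form (thetaL g w) ((2 : ℝ) • ⁅thetaL g u, thetaL g v⁆))

/-- The quadratic form `ξ ↦ ½ ξ · ξ`: in its Clifford algebra
`ξ ζ + ζ ξ = ξ · ζ`, so an orthonormal basis satisfies `xᵢ xⱼ + xⱼ xᵢ = δᵢⱼ`. -/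
def quadForm : QuadraticForm ℝ (GroupLieAlgebra 𝓘(ℝ, EG) G) :=
  (1 / 2 : ℝ) • LinearMap.BilinMap.toQuadraticMap B.form

/-- The Clifford algebra `Cl(𝔤)`. -/
abbrev Cl : Type _ := CliffordAlgebra B.quadForm

/-- The group `Pin(𝔤)`: the subgroup of `Cl(𝔤)ˣ` generated by the `ξ ∈ 𝔤` with `ξ · ξ = 2`. -/
def Pin : Subgroup B.Clˣ :=
  Subgroup.closure {x | ∃ ξ, B.form ξ ξ = 2 ∧ (x : B.Cl) = CliffordAlgebra.ι B.quadForm ξ}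

/-- A lift of the adjoint action `Ad : G → O(𝔤)` to a continuous group homomorphism
`τ : G → Pin(𝔤)`, where `x ∈ Pin(𝔤)` acts on `𝔤 ⊂ Cl(𝔤)` by `y ↦ α(x) y x⁻¹` with the parity
operator `α`. Continuity is with respect to the topology of the finite-dimensional real vector
space `Cl(𝔤)`, hence can be tested with linear functionals. -/
structure PinLift where
  toHom : G →* B.Pin
  lifts : ∀ (g : G) (ξ : GroupLieAlgebra 𝓘(ℝ, EG) G),
    CliffordAlgebra.involute ((toHom g : B.Clˣ) : B.Cl) * CliffordAlgebra.ι B.quadForm ξ *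
      (((toHom g : B.Clˣ)⁻¹ : B.Clˣ) : B.Cl) =
    CliffordAlgebra.ι B.quadForm (adjointAction g ξ)
  continuous : ∀ l : Module.Dual ℝ B.Cl, Continuous fun g => l ((toHom g : B.Clˣ) : B.Cl)

/-- The symbol map `Cl(𝔤) → ⋀ 𝔤`, taking `xᵢ₁ ⋯ xᵢₛ` to `yᵢ₁ ⋯ yᵢₛ` for `i₁ < ⋯ < iₛ` and any
orthonormal basis. -/
def symbol : B.Cl ≃ₗ[ℝ] ExteriorAlgebra ℝ (GroupLieAlgebra 𝓘(ℝ, EG) G) :=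
  CliffordAlgebra.equivExterior B.quadForm

variable (EG G) in
/-- The map `s_{1/2}` of `⋀ 𝔤`, multiplication by `2⁻ˡ` on `⋀ˡ 𝔤`. -/
def scaleHalf : ExteriorAlgebra ℝ (GroupLieAlgebra 𝓘(ℝ, EG) G) →ₐ[ℝ]
    ExteriorAlgebra ℝ (GroupLieAlgebra 𝓘(ℝ, EG) G) :=
  ExteriorAlgebra.map ((1 / 2 : ℝ) • LinearMap.id)

/-- `ξ ↦ (θᴿ · ξ)_g`, which takes `eᵢ` to `(θᴿᵢ)_g` for an orthonormal basis `eᵢ`. -/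
def thetaRDual (g : G) :
    GroupLieAlgebra 𝓘(ℝ, EG) G →ₗ[ℝ] Module.Dual ℝ (TangentSpace 𝓘(ℝ, EG) g) :=
  LinearMap.compl₂ B.form (thetaR g).toLinearMap

/-- The mixed-degree form `𝒯` on `G`: at `g`, the element `s_{1/2}(σ(τ(g)))` of `⋀ 𝔤`,
viewed in `⋀ T_g^* G` through right-invariant forms. -/
def formT {B : InvariantInnerProduct EG G} (τ : B.PinLift) (g : G) :
    ExteriorAlgebra ℝ (Module.Dual ℝ (TangentSpace 𝓘(ℝ, EG) g)) :=
  ExteriorAlgebra.map (B.thetaRDual g)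
    (scaleHalf EG G (B.symbol ((τ.toHom g : B.Clˣ) : B.Cl)))

end InvariantInnerProduct

end LieGroups

/-! ### Group valued Hamiltonian manifolds -/

section Hamiltonian

variable {EG : Type*} [NormedAddCommGroup EG] [NormedSpace ℝ EG]
  {G : Type*} [TopologicalSpace G] [ChartedSpace EG G] [Group G]
  {EM : Type*} [NormedAddCommGroup EM] [NormedSpace ℝ EM]
  {M : Type*} [TopologicalSpace M] [ChartedSpace EM M] [MulAction G M]

/-- The generating vector field `ξ_M(m) = d/dt|_{t=0} exp(-tξ).m`, that is, the image of `-ξ`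
under the derivative at `1` of `g ↦ g.m`. -/
def generatingField (ξ : GroupLieAlgebra 𝓘(ℝ, EG) G) (m : M) : TangentSpace 𝓘(ℝ, EM) m :=
  mfderiv 𝓘(ℝ, EG) 𝓘(ℝ, EM) (fun g : G => g • m) 1 (-ξ)

variable (EM M) in
/-- The structure of a group valued Hamiltonian `G`-manifold on the smooth `G`-manifold `M`:
an invariant 2-form `twoForm` and an equivariant map `Φ : M → G` (for the conjugation action on
`G`) such that `dω = Φ^* η`, `ι(ξ_M) ω = ½ Φ^*(θᴸ + θᴿ) · ξ` and
`ker ω_m = {ξ_M(m) | (Ad_{Φ(m)} + 1) ξ = 0}`. -/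
structure GroupValuedHamiltonian (B : InvariantInnerProduct EG G) where
  twoForm : DiffForm EM M 2
  Φ : M → G
  smooth_twoForm : twoForm.IsSmooth
  smooth_Φ : ContMDiff 𝓘(ℝ, EM) 𝓘(ℝ, EG) ∞ Φ
  invariant : ∀ (g : G) (m : M), (twoForm (g • m)).compContinuousLinearMap
    (mfderiv 𝓘(ℝ, EM) 𝓘(ℝ, EM) (fun x : M => g • x) m) = twoForm m
  equivariant : ∀ (g : G) (m : M), Φ (g • m) = g * Φ m * g⁻¹
  d_twoForm : ∀ (m : M) (u v w : TangentSpace 𝓘(ℝ, EM) m),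
    twoForm.d m ![u, v, w] = B.eta (Φ m) (mfderiv 𝓘(ℝ, EM) 𝓘(ℝ, EG) Φ m u)
      (mfderiv 𝓘(ℝ, EM) 𝓘(ℝ, EG) Φ m v) (mfderiv 𝓘(ℝ, EM) 𝓘(ℝ, EG) Φ m w)
  moment : ∀ (ξ : GroupLieAlgebra 𝓘(ℝ, EG) G) (m : M) (v : TangentSpace 𝓘(ℝ, EM) m),
    twoForm m ![generatingField ξ m, v] =
      (1 / 2) * B.form (thetaL (Φ m) (mfderiv 𝓘(ℝ, EM) 𝓘(ℝ, EG) Φ m v) +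
        thetaR (Φ m) (mfderiv 𝓘(ℝ, EM) 𝓘(ℝ, EG) Φ m v)) ξ
  ker_twoForm : ∀ (m : M) (v : TangentSpace 𝓘(ℝ, EM) m),
    (∀ w, twoForm m ![v, w] = 0) ↔
      ∃ ξ : GroupLieAlgebra 𝓘(ℝ, EG) G, adjointAction (Φ m) ξ + ξ = 0 ∧ v = generatingField ξ m

namespace GroupValuedHamiltonian

variable {B : InvariantInnerProduct EG G} (X : GroupValuedHamiltonian EM M B)

/-- The pull-back at `m` of mixed-degree forms under `Φ`. -/
def pullback (m : M) :
    ExteriorAlgebra ℝ (Module.Dual ℝ (TangentSpace 𝓘(ℝ, EG) (X.Φ m))) →ₐ[ℝ]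
      ExteriorAlgebra ℝ (Module.Dual ℝ (TangentSpace 𝓘(ℝ, EM) m)) :=
  ExteriorAlgebra.map (mfderiv 𝓘(ℝ, EM) 𝓘(ℝ, EG) X.Φ m).toLinearMap.dualMap

variable [FiniteDimensional ℝ EM]

/-- The mixed-degree form `exp(ω)`. -/
def expOmega (m : M) : ExteriorAlgebra ℝ (Module.Dual ℝ (TangentSpace 𝓘(ℝ, EM) m)) :=
  expTwoForm (X.twoForm m)

/-- The mixed-degree form `Γ = exp(ω) Φ^*𝒯`. -/
def Gam (τ : B.PinLift) (m : M) :
    ExteriorAlgebra ℝ (Module.Dual ℝ (TangentSpace 𝓘(ℝ, EM) m)) :=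
  X.expOmega m * X.pullback m (InvariantInnerProduct.formT τ (X.Φ m))

/-- The top degree part `Γ_[dim M]`. -/
def GamTop (τ : B.PinLift) : DiffForm EM M (Module.finrank ℝ EM) :=
  fun m => formPart (Module.finrank ℝ EM) (X.Gam τ m)

/-- The top degree part `exp(ω)_[dim M]`. -/
def expOmegaTop : DiffForm EM M (Module.finrank ℝ EM) :=
  fun m => formPart (Module.finrank ℝ EM) (X.expOmega m)

end GroupValuedHamiltonian

end Hamiltonian

end

/-!
At a point `m`, write `V` for the tangent space, `A = Ad_Φ(m)`, `β = ω_m`, and `μ : V → 𝔤` for the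
right-trivialized derivative of `Φ`. Then `Γ_m = exp β ∧ μ^* σ(τ(Φ(m)))` with the generators of
`⋀ 𝔤` halved, and the axioms of a group valued Hamiltonian manifold become
`β(ξ_M, v) = ½ μ(v) · (A ξ + ξ)` and `μ(ξ_M) = A ξ - ξ`, together with the description of `ker β`
(`ExteriorForm.HamiltonianPoint`, `ExteriorForm.hamiltonianPoint`). Everything but smoothness is
linear algebra with these data.

*Nonvanishing.* The relation `α(τ) ξ = (A ξ) τ` translates into
`(A ξ - ξ) ∧ σ(τ) = -½ ι(A ξ + ξ) σ(τ)` (`ExteriorForm.IsLift.ι_mul_symb`). If `μ(v) = A ξ + ξ`, it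
follows that `ι(v) Γ = (ι(v) β - ½ (A ξ - ξ) · μ) ∧ Γ`. Solving `μ(v) = A ξ + ξ` leaves a
`dim V`-dimensional space of pairs `(v, ξ)`, on which the covector on the right is injective by the
condition on `ker β`; thus every covector acts on `Γ` as an interior product
(`ExteriorForm.HamiltonianPoint.exists_vec_of_covector`). By Euler's identity, a form with this
property is determined by its top degree part
(`ExteriorForm.eq_zero_of_homPart_finrank_eq_zero`), so it remains to see that `μ^* σ(τ) ≠ 0`. The
kernel of `𝔤 → V*`, `ξ ↦ ξ · μ`, consists of vectors fixed by `A`, whose interior products kill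
`σ(τ)`, so `σ(τ)` comes from a complement of that kernel (`ExteriorForm.eq_zero_of_map_eq_zero`).

*Comparison with `exp β`.* Where `β` is nondegenerate, `A` has no eigenvalue `-1`. Let `L(y)` be the
top degree part of `exp β ∧ μ^* σ(y)`. The interior product with `ξ_M` has no top degree part, which
gives `L((A ξ + ξ) y) = L(ξ y - α(y) ξ)`. The functional `y ↦ scal(y τ⁻¹)`, with `scal` the degree
zero part of the symbol, satisfies the same relation, since `scal` is a graded trace. The relation
determines a functional from its value at `1`, hence `scal(τ) L(τ) = L(1)`
(`ExteriorForm.HamiltonianPoint.scalPart_smul_formPartAlg`). Finally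
`scal(τ)² = det ((1 + A) / 2)` (`ExteriorForm.IsLift.scalPart_sq`), by splitting off from `A` one
plane rotation at a time, written as a product of two reflections. The sign is that of
`scal(τ(Φ(m)))`.

*Smoothness.* The homomorphism `τ` is only assumed to be continuous. Near the identity, the symbol
equation expresses the interior products of `σ(τ(g))` through `Ad_g`, so all of `σ(τ(g))` is smooth
once its scalar part is, and the latter is the positive square root of `det ((1 + Ad_g) / 2)`.
Multiplicativity of `τ` extends this to all of `G` (`ExteriorForm.finSmoothAt_symb_liftElem`).
-/

noncomputable section

/-! ### Interior products and the grading of an exterior algebra -/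

namespace ExteriorForm

open ExteriorAlgebra

section Basics

variable {W U : Type*} [AddCommGroup W] [Module ℝ W] [AddCommGroup U] [Module ℝ U]

/-- The interior product with a covector `d`, an antiderivation of degree `-1` of `⋀ W`. -/
def contr (d : Module.Dual ℝ W) : ExteriorAlgebra ℝ W →ₗ[ℝ] ExteriorAlgebra ℝ W :=
  CliffordAlgebra.contractLeft (Q := (0 : QuadraticForm ℝ W)) d

/-- The projection to the homogeneous part of degree `k`. -/
def homPart (k : ℕ) : ExteriorAlgebra ℝ W →ₗ[ℝ] ExteriorAlgebra ℝ W :=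
  GradedAlgebra.proj (fun i : ℕ => ⋀[ℝ]^i W) k

theorem contr_add (d d' : Module.Dual ℝ W) (x : ExteriorAlgebra ℝ W) :
    contr (d + d') x = contr d x + contr d' x := by simp [contr]

theorem contr_smul (r : ℝ) (d : Module.Dual ℝ W) (x : ExteriorAlgebra ℝ W) :
    contr (r • d) x = r • contr d x := by simp [contr]

theorem contr_ι_mul (d : Module.Dual ℝ W) (a : W) (x : ExteriorAlgebra ℝ W) :
    contr d (ι ℝ a * x) = d a • x - ι ℝ a * contr d x :=
  CliffordAlgebra.contractLeft_ι_mul (Q := (0 : QuadraticForm ℝ W)) d a x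

@[simp]
theorem contr_algebraMap (d : Module.Dual ℝ W) (r : ℝ) :
    contr d (algebraMap ℝ (ExteriorAlgebra ℝ W) r) = 0 :=
  CliffordAlgebra.contractLeft_algebraMap (0 : QuadraticForm ℝ W) d r

@[simp]
theorem contr_one (d : Module.Dual ℝ W) : contr d (1 : ExteriorAlgebra ℝ W) = 0 :=
  CliffordAlgebra.contractLeft_one (0 : QuadraticForm ℝ W) d

theorem left_induction {P : ExteriorAlgebra ℝ W → Prop}
    (algebraMap : ∀ r : ℝ, P (algebraMap ℝ _ r)) (add : ∀ x y, P x → P y → P (x + y))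
    (ι_mul : ∀ x a, P x → P (ι ℝ a * x)) : ∀ x, P x :=
  CliffordAlgebra.left_induction (Q := (0 : QuadraticForm ℝ W)) algebraMap add
    (fun x a h => ι_mul x a h)

theorem ι_mul_swap (a b : W) (x : ExteriorAlgebra ℝ W) :
    ι ℝ a * (ι ℝ b * x) = -(ι ℝ b * (ι ℝ a * x)) := by
  have h := ι_add_mul_swap (R := ℝ) a b
  rw [← mul_assoc, ← mul_assoc, eq_neg_iff_add_eq_zero, ← add_mul, h, zero_mul]

theorem homPart_eq_decompose (k : ℕ) (x : ExteriorAlgebra ℝ W) :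
    homPart k x = (DirectSum.decompose (fun i : ℕ => ⋀[ℝ]^i W) x k : ExteriorAlgebra ℝ W) := rfl

theorem homPart_mem (k : ℕ) (x : ExteriorAlgebra ℝ W) : homPart k x ∈ ⋀[ℝ]^k W := by
  rw [homPart_eq_decompose]; exact SetLike.coe_mem _

theorem homPart_of_mem {k : ℕ} {x : ExteriorAlgebra ℝ W} (hx : x ∈ ⋀[ℝ]^k W) :
    homPart k x = x := by
  rw [homPart_eq_decompose, DirectSum.decompose_of_mem_same (fun i : ℕ => ⋀[ℝ]^i W) hx]

theorem homPart_of_mem_ne {k l : ℕ} {x : ExteriorAlgebra ℝ W} (hx : x ∈ ⋀[ℝ]^l W) (h : l ≠ k) :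
    homPart k x = 0 := by
  rw [homPart_eq_decompose, DirectSum.decompose_of_mem_ne (fun i : ℕ => ⋀[ℝ]^i W) hx h]

theorem ι_mem_one (a : W) : ι ℝ a ∈ ⋀[ℝ]^1 W := by
  simpa only [pow_one] using LinearMap.mem_range_self (ι ℝ) a

theorem algebraMap_mem_zero (r : ℝ) : algebraMap ℝ (ExteriorAlgebra ℝ W) r ∈ ⋀[ℝ]^0 W :=
  SetLike.algebraMap_mem_graded (fun i : ℕ => ⋀[ℝ]^i W) r

theorem homPart_zero_algebraMap (r : ℝ) :
    homPart 0 (algebraMap ℝ (ExteriorAlgebra ℝ W) r) = algebraMap ℝ _ r :=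
  homPart_of_mem (algebraMap_mem_zero r)

theorem homPart_succ_algebraMap (k : ℕ) (r : ℝ) :
    homPart (k + 1) (algebraMap ℝ (ExteriorAlgebra ℝ W) r) = 0 :=
  homPart_of_mem_ne (algebraMap_mem_zero r) (by omega)

theorem homPart_succ_ι_mul (k : ℕ) (a : W) (x : ExteriorAlgebra ℝ W) :
    homPart (k + 1) (ι ℝ a * x) = ι ℝ a * homPart k x := by
  rw [homPart_eq_decompose, homPart_eq_decompose, add_comm k 1,
    DirectSum.coe_decompose_mul_add_of_left_mem (fun i : ℕ => ⋀[ℝ]^i W) (ι_mem_one a)]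

theorem homPart_zero_ι_mul (a : W) (x : ExteriorAlgebra ℝ W) :
    homPart 0 (ι ℝ a * x) = 0 := by
  rw [homPart_eq_decompose,
    DirectSum.coe_decompose_mul_of_left_mem_of_not_le (fun i : ℕ => ⋀[ℝ]^i W) (ι_mem_one a)]
  omega

theorem ext_homPart {x y : ExteriorAlgebra ℝ W} (h : ∀ k, homPart k x = homPart k y) : x = y := by
  apply (DirectSum.decompose (fun i : ℕ => ⋀[ℝ]^i W)).injective
  apply DFinsupp.ext
  intro k
  exact Subtype.ext (h k)

theorem contr_homPart_aux (d : Module.Dual ℝ W) (x : ExteriorAlgebra ℝ W) :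
    contr d (homPart 0 x) = 0 ∧
      ∀ k, contr d (homPart (k + 1) x) = homPart k (contr d x) := by
  induction x using left_induction with
  | algebraMap r =>
    simp [homPart_zero_algebraMap, homPart_succ_algebraMap]
  | add x y hx hy =>
    refine ⟨by simp [hx.1, hy.1], fun k => by simp [hx.2 k, hy.2 k]⟩
  | ι_mul x a hx =>
    refine ⟨by simp [homPart_zero_ι_mul], fun k => ?_⟩
    rw [homPart_succ_ι_mul, contr_ι_mul, contr_ι_mul, map_sub, map_smul]
    cases k with
    | zero => rw [hx.1, homPart_zero_ι_mul, mul_zero]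
    | succ k => rw [hx.2, homPart_succ_ι_mul]

theorem contr_homPart_zero (d : Module.Dual ℝ W) (x : ExteriorAlgebra ℝ W) :
    contr d (homPart 0 x) = 0 := (contr_homPart_aux d x).1

theorem contr_homPart_succ (d : Module.Dual ℝ W) (k : ℕ) (x : ExteriorAlgebra ℝ W) :
    contr d (homPart (k + 1) x) = homPart k (contr d x) := (contr_homPart_aux d x).2 k

/-- Euler's identity: `∑ᵢ bᵢ ∧ ι(bⁱ)` is multiplication by `k` in degree `k`. -/
theorem sum_ι_mul_contr {n : Type*} [Fintype n] (b : Module.Basis n ℝ W) (k : ℕ)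
    (x : ExteriorAlgebra ℝ W) :
    ∑ i, ι ℝ (b i) * contr (b.coord i) (homPart k x) = (k : ℝ) • homPart k x := by
  induction x using left_induction generalizing k with
  | algebraMap r =>
    cases k with
    | zero => simp [contr_homPart_zero]
    | succ k => simp [homPart_succ_algebraMap]
  | add x y hx hy => simp [mul_add, Finset.sum_add_distrib, hx, hy]
  | ι_mul x a hx =>
    cases k with
    | zero => simp [homPart_zero_ι_mul]
    | succ k =>
      have hsum : ∑ i, b.coord i a • ι ℝ (b i) = ι ℝ a := by
        conv_rhs => rw [← b.sum_repr a, map_sum]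
        exact Finset.sum_congr rfl fun i _ => (map_smul _ _ _).symm
      simp only [homPart_succ_ι_mul, contr_ι_mul, mul_sub, Finset.sum_sub_distrib]
      have h1 : ∑ i, ι ℝ (b i) * (b.coord i a • homPart k x) = ι ℝ a * homPart k x := by
        rw [← hsum, Finset.sum_mul]
        exact Finset.sum_congr rfl fun i _ => by rw [mul_smul_comm, smul_mul_assoc]
      have h2 : ∑ i, ι ℝ (b i) * (ι ℝ a * contr (b.coord i) (homPart k x)) =
          -((k : ℝ) • (ι ℝ a * homPart k x)) := by
        rw [← mul_smul_comm, ← hx, Finset.mul_sum, ← Finset.sum_neg_distrib]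
        exact Finset.sum_congr rfl fun i _ => ι_mul_swap _ _ _
      rw [h1, h2]
      push_cast
      module

theorem homPart_eq_zero_of_finrank_lt [FiniteDimensional ℝ W] {k : ℕ}
    (h : Module.finrank ℝ W < k) (x : ExteriorAlgebra ℝ W) : homPart k x = 0 := by
  have h0 : Module.finrank ℝ (⋀[ℝ]^k W) = 0 := by
    rw [exteriorPower.finrank_eq, Nat.choose_eq_zero_of_lt h]
  have := Module.finrank_zero_iff.1 h0
  exact congrArg Subtype.val (Subsingleton.elim (⟨homPart k x, homPart_mem k x⟩ : ⋀[ℝ]^k W) 0)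

theorem sum_homPart [FiniteDimensional ℝ W] (x : ExteriorAlgebra ℝ W) :
    ∑ k ∈ Finset.range (Module.finrank ℝ W + 1), homPart k x = x := by
  refine ext_homPart fun l => ?_
  rw [map_sum]
  by_cases hl : l < Module.finrank ℝ W + 1
  · rw [Finset.sum_eq_single l, homPart_of_mem (homPart_mem l x)]
    · intro k _ hk
      exact homPart_of_mem_ne (homPart_mem k x) hk
    · intro h
      exact absurd (Finset.mem_range.2 hl) h
  · rw [homPart_eq_zero_of_finrank_lt (by omega) x]
    exact Finset.sum_eq_zero fun k _ => homPart_eq_zero_of_finrank_lt (by omega) _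

theorem contr_map (f : W →ₗ[ℝ] U) (d : Module.Dual ℝ U) (x : ExteriorAlgebra ℝ W) :
    contr d (ExteriorAlgebra.map f x) = ExteriorAlgebra.map f (contr (d ∘ₗ f) x) := by
  induction x using left_induction with
  | algebraMap r => simp
  | add x y hx hy => simp [hx, hy]
  | ι_mul x a hx => simp [contr_ι_mul, hx]

/-- A multi-vector `φ` such that exterior multiplication by each vector agrees on `φ` with an
interior product is determined by its part of top degree. -/
theorem eq_zero_of_homPart_finrank_eq_zero [FiniteDimensional ℝ W] {φ : ExteriorAlgebra ℝ W}
    (h : ∀ a : W, ∃ d : Module.Dual ℝ W, ι ℝ a * φ = contr d φ)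
    (htop : homPart (Module.finrank ℝ W) φ = 0) : φ = 0 := by
  have key : ∀ j k, Module.finrank ℝ W ≤ k + j → homPart k φ = 0 := by
    intro j
    induction j using Nat.strong_induction_on with
    | _ j ih =>
      intro k hk
      rcases lt_trichotomy k (Module.finrank ℝ W) with hlt | rfl | hgt
      · have hz : ∀ a : W, ι ℝ a * homPart k φ = 0 := by
          intro a
          obtain ⟨d, hd⟩ := h a
          have h2 : homPart (k + 2) φ = 0 := by
            rcases Nat.lt_or_ge j 2 with hj | hj
            · exact homPart_eq_zero_of_finrank_lt (by omega) φ
            · exact ih (j - 2) (by omega) (k + 2) (by omega)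
          rw [← homPart_succ_ι_mul, hd, ← contr_homPart_succ, h2, map_zero]
        let b := Module.finBasis ℝ W
        have he := sum_ι_mul_contr b k φ
        -- Summing `bⁱ ⌟ (bᵢ ∧ φₖ) = 0` over `i` gives `(dim W - k) φₖ = 0`.
        have h3 : ∀ i, ι ℝ (b i) * contr (b.coord i) (homPart k φ) = homPart k φ := by
          intro i
          have := contr_ι_mul (b.coord i) (b i) (homPart k φ)
          rw [hz, map_zero] at this
          rw [eq_comm, sub_eq_zero] at this
          rw [← this]
          simp
        simp only [h3, Finset.sum_const, Finset.card_univ, Fintype.card_fin] at he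
        rw [← Nat.cast_smul_eq_nsmul ℝ, ← sub_eq_zero, ← sub_smul, smul_eq_zero] at he
        refine he.resolve_left ?_
        rw [sub_eq_zero, Nat.cast_inj]
        omega
      · exact htop
      · exact homPart_eq_zero_of_finrank_lt hgt φ
  exact ext_homPart fun k => by rw [key (Module.finrank ℝ W) k (by omega), map_zero]

/-- A multi-vector on which each interior product agrees with an exterior multiplication is
determined by its scalar part. -/
theorem eq_zero_of_homPart_zero_eq_zero [FiniteDimensional ℝ W] {y : ExteriorAlgebra ℝ W}
    (h : ∀ d : Module.Dual ℝ W, ∃ a : W, contr d y = ι ℝ a * y) (h0 : homPart 0 y = 0) :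
    y = 0 := by
  refine ext_homPart fun k => ?_
  rw [map_zero]
  induction k using Nat.strong_induction_on with
  | _ k ih =>
    cases k with
    | zero => exact h0
    | succ k =>
      have hd : ∀ d, contr d (homPart (k + 1) y) = 0 := by
        intro d
        obtain ⟨a, ha⟩ := h d
        rw [contr_homPart_succ, ha]
        cases k with
        | zero => exact homPart_zero_ι_mul a y
        | succ k => rw [homPart_succ_ι_mul, ih k (by omega), mul_zero]
      have he := sum_ι_mul_contr (Module.finBasis ℝ W) (k + 1) y
      simp only [hd, mul_zero, Finset.sum_const_zero] at he
      refine (smul_eq_zero.1 he.symm).resolve_left ?_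
      positivity

/-- A linear map on `⋀ W` under which every exterior multiplication can be traded for an interior
product is determined by its value at `1`. -/
theorem linearMap_eq_zero_of_trade {X : Type*} [AddCommGroup X] [Module ℝ X]
    (G : ExteriorAlgebra ℝ W →ₗ[ℝ] X)
    (h : ∀ a : W, ∃ d : Module.Dual ℝ W, ∀ y, G (ι ℝ a * y) = G (contr d y)) (h1 : G 1 = 0) :
    G = 0 := by
  have key : ∀ k, ∀ y, G (homPart k y) = 0 := by
    intro k
    induction k using Nat.strong_induction_on with
    | _ k ih =>
      intro y
      induction y using left_induction with
      | algebraMap r =>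
        cases k with
        | zero => rw [homPart_zero_algebraMap, Algebra.algebraMap_eq_smul_one, map_smul, h1,
            smul_zero]
        | succ k => rw [homPart_succ_algebraMap, map_zero]
      | add x y hx hy => rw [map_add, map_add, hx, hy, add_zero]
      | ι_mul x a _ =>
        cases k with
        | zero => rw [homPart_zero_ι_mul, map_zero]
        | succ k =>
          obtain ⟨d, hd⟩ := h a
          rw [homPart_succ_ι_mul, hd]
          cases k with
          | zero => rw [contr_homPart_zero, map_zero]
          | succ k => rw [contr_homPart_succ]; exact ih k (by omega) _
  refine LinearMap.ext fun y => ?_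
  classical
  have hy := DirectSum.sum_support_decompose (fun i : ℕ => ⋀[ℝ]^i W) y
  rw [← hy, map_sum]
  exact Finset.sum_eq_zero fun k _ => key k y

theorem map_sub_smulRight (d : Module.Dual ℝ W) (k : W)
    (x : ExteriorAlgebra ℝ W) :
    ExteriorAlgebra.map (LinearMap.id - d.smulRight k) x = x - ι ℝ k * contr d x := by
  induction x using left_induction with
  | algebraMap r => simp
  | add x y hx hy => simp only [map_add, hx, hy, mul_add]; abel
  | ι_mul x a hx =>
    have h2 : ι ℝ k * (ι ℝ k * contr d x) = 0 := by rw [← mul_assoc, ι_sq_zero, zero_mul]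
    simp only [map_mul, map_apply_ι, LinearMap.sub_apply, LinearMap.id_apply,
      LinearMap.smulRight_apply, hx, map_sub, map_smul, contr_ι_mul, sub_mul, mul_sub,
      smul_mul_assoc, mul_smul_comm, h2]
    rw [ι_mul_swap a k]
    module

/-- If the interior products annihilating `y` separate the points of `ker f`, then `y` comes from
a complement of `ker f`, so that `⋀ f` does not kill it. -/
theorem eq_zero_of_map_eq_zero [FiniteDimensional ℝ W] (f : W →ₗ[ℝ] U) (y : ExteriorAlgebra ℝ W)
    (hker : ∀ k, f k = 0 → k ≠ 0 → ∃ d : Module.Dual ℝ W, contr d y = 0 ∧ d k ≠ 0)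
    (hy : ExteriorAlgebra.map f y = 0) : y = 0 := by
  induction hn : Module.finrank ℝ (LinearMap.ker f) using Nat.strong_induction_on
    generalizing U with
  | _ n ih =>
    by_cases hf : LinearMap.ker f = ⊥
    · exact map_injective_field hf (by rw [hy, map_zero])
    · obtain ⟨k, hk, hk0⟩ := Submodule.exists_mem_ne_zero_of_ne_bot hf
      rw [LinearMap.mem_ker] at hk
      obtain ⟨d, hd, hdk⟩ := hker k hk hk0
      -- Replacing `f` by `(f, d)` removes `k` from the kernel.
      have hlt : LinearMap.ker (f.prod d) < LinearMap.ker f := by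
        refine lt_of_le_of_ne (fun x hx => ?_) fun he => ?_
        · rw [LinearMap.mem_ker] at hx ⊢
          exact congrArg Prod.fst hx
        · have : k ∈ LinearMap.ker (f.prod d) := by rw [he]; exact hk
          exact hdk (congrArg Prod.snd (LinearMap.mem_ker.1 this))
      refine ih _ (hn ▸ Submodule.finrank_lt_finrank_of_lt hlt) (f.prod d) ?_ ?_ rfl
      · intro k' hk'
        exact hker k' (congrArg Prod.fst hk')
      · have h1 : ExteriorAlgebra.map (LinearMap.id - d.smulRight ((d k)⁻¹ • k)) y = y := by
          rw [map_sub_smulRight, hd, mul_zero, sub_zero]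
        have h2 : (f.prod d) ∘ₗ (LinearMap.id - d.smulRight ((d k)⁻¹ • k)) =
            (LinearMap.inl ℝ U ℝ) ∘ₗ f := by
          ext x
          · simp [hk]
          · simp [hdk]
        rw [← h1, ← AlgHom.comp_apply, map_comp_map, h2, ← map_comp_map, AlgHom.comp_apply, hy,
          map_zero]

end Basics

end ExteriorForm

/-! ### Mixed-degree forms: degree parts, 2-forms and their exponentials -/

namespace ExteriorForm

open ExteriorAlgebra

section Parts

variable {V V' : Type*} [AddCommGroup V] [Module ℝ V] [AddCommGroup V'] [Module ℝ V']

/-- The value on `v` of the degree `k` part, as a linear functional of the mixed-degree form. -/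
def formPartLin (V : Type*) [AddCommGroup V] [Module ℝ V] (k : ℕ) (v : Fin k → V) :
    ExteriorAlgebra ℝ (Module.Dual ℝ V) →ₗ[ℝ] ℝ where
  toFun x := formPartAlg k x v
  map_add' x y := by simp [formPartAlg]
  map_smul' r x := by
    simp only [formPartAlg, DirectSum.decompose_smul]
    simp [DirectSum.smul_apply]

theorem formPartLin_apply (k : ℕ) (v : Fin k → V) (x : ExteriorAlgebra ℝ (Module.Dual ℝ V)) :
    formPartLin V k v x = formPartAlg k x v := rfl

theorem formPartAlg_homPart (k : ℕ) (x : ExteriorAlgebra ℝ (Module.Dual ℝ V)) :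
    formPartAlg k (homPart k x) = formPartAlg k x := by
  have h : DirectSum.decompose (fun i : ℕ => ⋀[ℝ]^i (Module.Dual ℝ V)) (homPart k x) k =
      DirectSum.decompose (fun i : ℕ => ⋀[ℝ]^i (Module.Dual ℝ V)) x k :=
    Subtype.ext (homPart_of_mem (homPart_mem k x))
  simp only [formPartAlg, h]

theorem formPartAlg_of_homPart_eq_zero {k : ℕ} {x : ExteriorAlgebra ℝ (Module.Dual ℝ V)}
    (h : homPart k x = 0) : formPartAlg k x = 0 := by
  rw [← formPartAlg_homPart, h]
  ext v
  exact (formPartLin V k v).map_zero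

theorem formPartAlg_coe (k : ℕ) (x : ⋀[ℝ]^k (Module.Dual ℝ V)) (v : Fin k → V) :
    formPartAlg k (x : ExteriorAlgebra ℝ (Module.Dual ℝ V)) v =
      exteriorPower.pairingDual ℝ V k x (exteriorPower.ιMulti ℝ k v) := by
  simp [formPartAlg]

theorem map_mem_exteriorPower {W U : Type*} [AddCommGroup W] [Module ℝ W] [AddCommGroup U]
    [Module ℝ U] (f : W →ₗ[ℝ] U) (k : ℕ) (x : ⋀[ℝ]^k W) :
    ExteriorAlgebra.map f (x : ExteriorAlgebra ℝ W) = (exteriorPower.map k f x : _) := by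
  have h : (ExteriorAlgebra.map f).toLinearMap ∘ₗ (⋀[ℝ]^k W).subtype =
      (⋀[ℝ]^k U).subtype ∘ₗ exteriorPower.map k f := by
    refine exteriorPower.linearMap_ext ?_
    ext v
    simp
  exact LinearMap.congr_fun h x

theorem homPart_map {W U : Type*} [AddCommGroup W] [Module ℝ W] [AddCommGroup U]
    [Module ℝ U] (f : W →ₗ[ℝ] U) (k : ℕ) (x : ExteriorAlgebra ℝ W) :
    homPart k (ExteriorAlgebra.map f x) = ExteriorAlgebra.map f (homPart k x) := by
  induction x using left_induction generalizing k with
  | algebraMap r => cases k <;> simp [homPart_zero_algebraMap, homPart_succ_algebraMap]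
  | add x y hx hy => simp [hx, hy]
  | ι_mul x a hx => cases k <;> simp [homPart_zero_ι_mul, homPart_succ_ι_mul, hx]

/-- Pulling back mixed-degree forms along `f` pulls back their homogeneous parts. -/
theorem formPartAlg_map_dualMap (f : V' →ₗ[ℝ] V) (k : ℕ)
    (x : ExteriorAlgebra ℝ (Module.Dual ℝ V)) (v : Fin k → V') :
    formPartAlg k (ExteriorAlgebra.map f.dualMap x) v = formPartAlg k x (fun i => f (v i)) := by
  rw [← formPartAlg_homPart, homPart_map, ← formPartAlg_homPart k x]
  obtain ⟨y, hy⟩ : ∃ y : ⋀[ℝ]^k (Module.Dual ℝ V), (y : ExteriorAlgebra ℝ _) = homPart k x :=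
    ⟨⟨_, homPart_mem k x⟩, rfl⟩
  rw [← hy, map_mem_exteriorPower, formPartAlg_coe, formPartAlg_coe]
  have h : ((exteriorPower.pairingDual ℝ V' k).flip (exteriorPower.ιMulti ℝ k v)) ∘ₗ
      exteriorPower.map k f.dualMap = (exteriorPower.pairingDual ℝ V k).flip
        (exteriorPower.ιMulti ℝ k (fun i => f (v i))) := by
    refine exteriorPower.linearMap_ext ?_
    ext w
    simp
  exact LinearMap.congr_fun h y

theorem homPart_eq_zero_of_formPartAlg [FiniteDimensional ℝ V] {k : ℕ}
    {x : ExteriorAlgebra ℝ (Module.Dual ℝ V)} (h : formPartAlg k x = 0) : homPart k x = 0 := by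
  obtain ⟨y, hy⟩ : ∃ y : ⋀[ℝ]^k (Module.Dual ℝ V), (y : ExteriorAlgebra ℝ _) = homPart k x :=
    ⟨⟨_, homPart_mem k x⟩, rfl⟩
  rw [← formPartAlg_homPart, ← hy] at h
  rw [← hy]
  let b := Module.finBasis ℝ V
  have h1 : ∀ s, (b.dualBasis.exteriorPower k).repr y s = 0 := by
    intro s
    have hs := DFunLike.congr_fun h (b ∘ (Set.powersetCard.ofFinEmbEquiv.symm s))
    rw [formPartAlg_coe] at hs
    rw [← (b.dualBasis.exteriorPower k).sum_repr y] at hs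
    simp only [map_sum, map_smul, LinearMap.sum_apply, LinearMap.smul_apply] at hs
    rw [Finset.sum_eq_single s] at hs
    · rw [exteriorPower.basis_apply, exteriorPower.ιMulti_family,
        exteriorPower.pairingDual_apply_apply_eq_one (x := b) (f := b.dualBasis)] at hs
      · simpa using hs
      · intro i; simp
      · intro i j hij; simp [Ne.symm hij]
    · intro t _ hts
      rw [exteriorPower.basis_apply, exteriorPower.ιMulti_family,
        exteriorPower.pairingDual_apply_apply_eq_one_zero (x := b) (f := b.dualBasis), smul_zero]
      · intro i j hij; simp [Ne.symm hij]
      · intro he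
        exact hts (Set.powersetCard.ofFinEmbEquiv.symm.injective he)
    · intro hs'; exact absurd (Finset.mem_univ s) hs'
  have : y = 0 := by
    rw [← (b.dualBasis.exteriorPower k).sum_repr y]
    exact Finset.sum_eq_zero fun s _ => by rw [h1 s, zero_smul]
  rw [this]; rfl

end Parts

section TwoForms

variable {V : Type*} [AddCommGroup V] [Module ℝ V] [TopologicalSpace V]
  {V' : Type*} [AddCommGroup V'] [Module ℝ V'] [TopologicalSpace V']

theorem alt_two_swap (β : V [⋀^Fin 2]→L[ℝ] ℝ) (v w : V) : β ![v, w] = -β ![w, v] := by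
  have h := β.toAlternatingMap.map_swap ![w, v] (i := 0) (j := 1) (by decide)
  have e : ![w, v] ∘ (Equiv.swap (0 : Fin 2) 1) = ![v, w] := by
    ext i; fin_cases i <;> simp
  rw [e] at h
  exact h

/-- The map `v ↦ β(v, ·)` of a 2-form `β`. -/
def twoFormFlat (β : V [⋀^Fin 2]→L[ℝ] ℝ) : V →ₗ[ℝ] Module.Dual ℝ V :=
  have hup : ∀ v w : V, Function.update ![v, 0] 1 w = ![v, w] := by
    intro v w
    ext i; fin_cases i <;> rfl
  have hadd : ∀ v w w', β ![v, w + w'] = β ![v, w] + β ![v, w'] := by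
    intro v w w'
    have := β.toAlternatingMap.map_update_add ![v, 0] 1 w w'
    rw [hup, hup, hup] at this
    exact this
  have hsmul : ∀ (r : ℝ) v w, β ![v, r • w] = r * β ![v, w] := by
    intro r v w
    have := β.toAlternatingMap.map_update_smul ![v, 0] 1 r w
    rw [hup, hup] at this
    exact this
  LinearMap.mk₂ ℝ (fun v w => β ![v, w])
    (fun v v' w => by
      rw [alt_two_swap, hadd, alt_two_swap β v, alt_two_swap β v', neg_add])
    (fun r v w => by rw [alt_two_swap, hsmul, alt_two_swap β v, smul_eq_mul, mul_neg])
    (fun v w w' => hadd v w w')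
    (fun r v w => by rw [hsmul, smul_eq_mul])

@[simp]
theorem twoFormFlat_apply (β : V [⋀^Fin 2]→L[ℝ] ℝ) (v w : V) :
    twoFormFlat β v w = β ![v, w] := rfl

/-- The interior product with a vector of `V` on `⋀ V*`. -/
abbrev contrVec (v : V) :
    ExteriorAlgebra ℝ (Module.Dual ℝ V) →ₗ[ℝ] ExteriorAlgebra ℝ (Module.Dual ℝ V) :=
  contr (Module.Dual.eval ℝ V v)

variable [FiniteDimensional ℝ V] [FiniteDimensional ℝ V']

theorem contrVec_twoFormElem_mul (β : V [⋀^Fin 2]→L[ℝ] ℝ) (v : V)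
    (x : ExteriorAlgebra ℝ (Module.Dual ℝ V)) :
    contrVec v (twoFormElem β * x) =
      ι ℝ (twoFormFlat β v) * x + twoFormElem β * contrVec v x := by
  set b := Module.finBasis ℝ V with hb
  have hflat : ∀ u, twoFormFlat β u = ∑ j, β ![u, b j] • b.coord j := by
    intro u
    refine b.ext fun k => ?_
    simp [Finsupp.single_apply]
  have hv : twoFormFlat β v = ∑ i, b.coord i v • twoFormFlat β (b i) := by
    conv_lhs => rw [← b.sum_repr v, map_sum]
    exact Finset.sum_congr rfl fun i _ => map_smul _ _ _
  have h1 : ∑ i, ∑ j, (β ![b i, b j] * b.coord i v) • (ι ℝ (b.coord j) * x) =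
      ι ℝ (twoFormFlat β v) * x := by
    rw [hv]
    simp only [hflat, map_sum, map_smul, Finset.sum_mul, Finset.smul_sum, smul_mul_assoc,
      smul_smul]
    exact Finset.sum_congr rfl fun i _ => Finset.sum_congr rfl fun j _ => by rw [mul_comm]
  have h2 : ∑ i, ∑ j, (β ![b i, b j] * b.coord j v) • (ι ℝ (b.coord i) * x) =
      -(ι ℝ (twoFormFlat β v) * x) := by
    rw [Finset.sum_comm, ← h1, ← Finset.sum_neg_distrib]
    refine Finset.sum_congr rfl fun i _ => ?_
    rw [← Finset.sum_neg_distrib]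
    refine Finset.sum_congr rfl fun j _ => ?_
    rw [alt_two_swap β (b j) (b i)]
    module
  have h3 : ∀ i j, contrVec v (ι ℝ (b.coord i) * ι ℝ (b.coord j) * x) =
      b.coord i v • (ι ℝ (b.coord j) * x) - b.coord j v • (ι ℝ (b.coord i) * x) +
        ι ℝ (b.coord i) * ι ℝ (b.coord j) * contrVec v x := by
    intro i j
    simp only [mul_assoc, contr_ι_mul, Module.Dual.eval_apply, mul_sub, mul_smul_comm]
    abel
  simp only [twoFormElem, smul_mul_assoc, Finset.sum_mul, map_smul, map_sum, ← hb, h3]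
  simp only [smul_add, smul_sub, Finset.sum_add_distrib, Finset.sum_sub_distrib, smul_smul]
  rw [h1, h2]
  module

theorem contrVec_twoFormElem (β : V [⋀^Fin 2]→L[ℝ] ℝ) (v : V) :
    contrVec v (twoFormElem β) = ι ℝ (twoFormFlat β v) := by
  simpa using contrVec_twoFormElem_mul β v 1

theorem twoFormElem_mul_ι (β : V [⋀^Fin 2]→L[ℝ] ℝ) (α : Module.Dual ℝ V) :
    twoFormElem β * ι ℝ α = ι ℝ α * twoFormElem β := by
  have h : ∀ α β γ : Module.Dual ℝ V, ι ℝ β * ι ℝ γ * ι ℝ α = ι ℝ α * (ι ℝ β * ι ℝ γ) := by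
    intro α β γ
    rw [ι_mul_swap α β, mul_assoc]
    have := ι_mul_swap γ α 1
    rw [mul_one, mul_one] at this
    rw [this, mul_neg]
  simp only [twoFormElem, smul_mul_assoc, mul_smul_comm, Finset.sum_mul, Finset.mul_sum, h]

theorem twoFormElem_mem (β : V [⋀^Fin 2]→L[ℝ] ℝ) :
    twoFormElem β ∈ ⋀[ℝ]^2 (Module.Dual ℝ V) := by
  refine Submodule.smul_mem _ _ (Submodule.sum_mem _ fun i _ => Submodule.sum_mem _ fun j _ =>
    Submodule.smul_mem _ _ ?_)
  exact SetLike.mul_mem_graded (A := fun i : ℕ => ⋀[ℝ]^i (Module.Dual ℝ V))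
    (ι_mem_one _) (ι_mem_one _)

theorem twoFormElem_pow_eq_zero (β : V [⋀^Fin 2]→L[ℝ] ℝ) {k : ℕ}
    (hk : Module.finrank ℝ V < 2 * k) : twoFormElem β ^ k = 0 := by
  have h : twoFormElem β ^ k ∈ ⋀[ℝ]^(k • 2) (Module.Dual ℝ V) :=
    SetLike.pow_mem_graded (A := fun i : ℕ => ⋀[ℝ]^i (Module.Dual ℝ V)) k (twoFormElem_mem β)
  rw [← homPart_of_mem h]
  refine homPart_eq_zero_of_finrank_lt ?_ _
  rw [Subspace.dual_finrank_eq, smul_eq_mul]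
  omega

theorem contrVec_twoFormElem_pow (β : V [⋀^Fin 2]→L[ℝ] ℝ) (v : V) (k : ℕ)
    (x : ExteriorAlgebra ℝ (Module.Dual ℝ V)) :
    contrVec v (twoFormElem β ^ (k + 1) * x) =
      (k + 1 : ℝ) • (ι ℝ (twoFormFlat β v) * (twoFormElem β ^ k * x)) +
        twoFormElem β ^ (k + 1) * contrVec v x := by
  induction k with
  | zero => simp [contrVec_twoFormElem_mul]
  | succ k ih =>
    rw [pow_succ', mul_assoc, contrVec_twoFormElem_mul, ih, mul_add, mul_smul_comm,
      ← mul_assoc (twoFormElem β) (ι ℝ _), twoFormElem_mul_ι, mul_assoc,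
      ← mul_assoc (twoFormElem β) (twoFormElem β ^ k), ← pow_succ',
      ← mul_assoc (twoFormElem β) (twoFormElem β ^ (k + 1)), ← pow_succ']
    push_cast
    module

theorem expTwoForm_mul_ι_mul (β : V [⋀^Fin 2]→L[ℝ] ℝ) (α : Module.Dual ℝ V)
    (x : ExteriorAlgebra ℝ (Module.Dual ℝ V)) :
    expTwoForm β * (ι ℝ α * x) = ι ℝ α * (expTwoForm β * x) := by
  have h : Commute (expTwoForm β) (ι ℝ α) :=
    Commute.sum_left _ _ _ fun k _ =>
      (Commute.pow_left (twoFormElem_mul_ι β α) k).smul_left _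
  rw [← mul_assoc, h.eq, mul_assoc]

/-- The interior product of `exp β ∧ x`. -/
theorem contrVec_expTwoForm_mul (β : V [⋀^Fin 2]→L[ℝ] ℝ) (v : V)
    (x : ExteriorAlgebra ℝ (Module.Dual ℝ V)) :
    contrVec v (expTwoForm β * x) =
      ι ℝ (twoFormFlat β v) * (expTwoForm β * x) + expTwoForm β * contrVec v x := by
  -- Truncating the exponential series is harmless: `β ^ (dim V)` is killed by any 1-form.
  set n := Module.finrank ℝ V with hn
  have hlast : ι ℝ (twoFormFlat β v) * (twoFormElem β ^ n * x) = 0 := by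
    rcases Nat.eq_zero_or_pos n with h0 | hpos
    · have : Subsingleton V := Module.finrank_zero_iff.1 (hn ▸ h0)
      have hz : twoFormFlat β v = 0 := by
        rw [Subsingleton.elim v 0, map_zero]
      rw [hz, map_zero, zero_mul]
    · rw [twoFormElem_pow_eq_zero β (by omega), zero_mul, mul_zero]
  have hsum : ∑ k ∈ Finset.range n, ((k + 1).factorial : ℝ)⁻¹ •
        ((k + 1 : ℝ) • (ι ℝ (twoFormFlat β v) * (twoFormElem β ^ k * x))) =
      ι ℝ (twoFormFlat β v) * (expTwoForm β * x) := by
    rw [expTwoForm, ← hn, Finset.sum_range_succ, add_mul, mul_add, smul_mul_assoc, mul_smul_comm,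
      hlast, smul_zero, add_zero, Finset.sum_mul, Finset.mul_sum]
    refine Finset.sum_congr rfl fun k _ => ?_
    rw [smul_mul_assoc, mul_smul_comm, smul_smul]
    congr 1
    rw [Nat.factorial_succ]
    push_cast
    field_simp
  rw [← hsum, expTwoForm, ← hn, Finset.sum_range_succ']
  simp only [add_mul, Finset.sum_mul, map_add, map_sum, smul_mul_assoc, map_smul,
    contrVec_twoFormElem_pow, smul_add, Finset.sum_add_distrib]
  simp
  abel

theorem isUnit_expTwoForm (β : V [⋀^Fin 2]→L[ℝ] ℝ) : IsUnit (expTwoForm β) := by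
  rw [expTwoForm, Finset.sum_range_succ']
  simp only [Nat.factorial_zero, Nat.cast_one, inv_one, pow_zero, one_smul]
  refine IsNilpotent.isUnit_add_one ?_
  have hnil : IsNilpotent (twoFormElem β) :=
    ⟨Module.finrank ℝ V + 1, twoFormElem_pow_eq_zero β (by omega)⟩
  have : ∑ k ∈ Finset.range (Module.finrank ℝ V),
      (((k + 1).factorial : ℝ)⁻¹) • twoFormElem β ^ (k + 1) = twoFormElem β *
      ∑ k ∈ Finset.range (Module.finrank ℝ V),
      (((k + 1).factorial : ℝ)⁻¹) • twoFormElem β ^ k := by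
    rw [Finset.mul_sum]
    exact Finset.sum_congr rfl fun k _ => by rw [mul_smul_comm, pow_succ']
  rw [this]
  refine Commute.isNilpotent_mul_right ?_ hnil
  exact Commute.sum_right _ _ _ fun k _ => ((Commute.refl _).pow_right k).smul_right _

theorem map_dualMap_twoFormElem (f : V' →L[ℝ] V) (β : V [⋀^Fin 2]→L[ℝ] ℝ) :
    ExteriorAlgebra.map f.toLinearMap.dualMap (twoFormElem β) =
      twoFormElem (β.compContinuousLinearMap f) := by
  rw [← sub_eq_zero]
  refine eq_zero_of_homPart_zero_eq_zero (fun d => ⟨0, ?_⟩) ?_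
  · obtain ⟨v, rfl⟩ := (Module.evalEquiv ℝ V').surjective d
    have hd : (Module.Dual.eval ℝ V' v) ∘ₗ f.toLinearMap.dualMap =
        Module.Dual.eval ℝ V (f v) := rfl
    have h := contrVec_twoFormElem (β.compContinuousLinearMap f) v
    have h' := contrVec_twoFormElem β (f v)
    rw [contrVec] at h h'
    rw [map_zero, zero_mul, map_sub, Module.evalEquiv_apply, contr_map, hd, h, h', map_apply_ι,
      sub_eq_zero]
    congr 1
    ext w
    simp
    congr 1
    ext i; fin_cases i <;> rfl
  · rw [map_sub, homPart_map, homPart_of_mem_ne (twoFormElem_mem β) (by decide),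
      homPart_of_mem_ne (twoFormElem_mem _) (by decide), map_zero, sub_zero]

end TwoForms

end ExteriorForm

/-! ### Clifford algebra of a Euclidean space and the symbol map -/

namespace ExteriorForm

open ExteriorAlgebra

section Clifford

variable {W : Type*} [AddCommGroup W] [Module ℝ W] {B : LinearMap.BilinForm ℝ W}

/-- The quadratic form `ξ ↦ ½ B(ξ, ξ)`. -/
abbrev halfQuad (B : LinearMap.BilinForm ℝ W) : QuadraticForm ℝ W :=
  (1 / 2 : ℝ) • LinearMap.BilinMap.toQuadraticMap B

/-- The symbol map of the Clifford algebra of `½ B`. -/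
abbrev symb (B : LinearMap.BilinForm ℝ W) :
    CliffordAlgebra (halfQuad B) ≃ₗ[ℝ] ExteriorAlgebra ℝ W :=
  CliffordAlgebra.equivExterior (halfQuad B)

/-- The degree zero component of the symbol. -/
def scalPart (B : LinearMap.BilinForm ℝ W) : CliffordAlgebra (halfQuad B) →ₗ[ℝ] ℝ :=
  (algebraMapInv (R := ℝ) (M := W)).toLinearMap ∘ₗ (symb B).toLinearMap

theorem algebraMapInv_algebraMap (r : ℝ) :
    algebraMapInv (algebraMap ℝ (ExteriorAlgebra ℝ W) r) = r :=
  algebraMap_leftInverse (R := ℝ) W r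

theorem algebraMapInv_ι_mul (a : W) (x : ExteriorAlgebra ℝ W) :
    algebraMapInv (ι ℝ a * x) = 0 := by
  simp [algebraMapInv]

theorem homPart_zero_eq (x : ExteriorAlgebra ℝ W) :
    homPart 0 x = algebraMap ℝ _ (algebraMapInv x) := by
  induction x using left_induction with
  | algebraMap r => rw [homPart_zero_algebraMap, algebraMapInv_algebraMap]
  | add x y hx hy => simp only [map_add, hx, hy]
  | ι_mul x a _ => rw [homPart_zero_ι_mul, algebraMapInv_ι_mul, map_zero]

theorem symb_one : symb B 1 = 1 :=
  CliffordAlgebra.changeForm_one CliffordAlgebra.changeForm.associated_neg_proof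

theorem symb_algebraMap (r : ℝ) : symb B (algebraMap ℝ _ r) = algebraMap ℝ _ r :=
  CliffordAlgebra.changeForm_algebraMap CliffordAlgebra.changeForm.associated_neg_proof r

theorem symb_ι (a : W) : symb B (CliffordAlgebra.ι (halfQuad B) a) = ι ℝ a :=
  CliffordAlgebra.changeForm_ι CliffordAlgebra.changeForm.associated_neg_proof a

theorem scalPart_one : scalPart B 1 = 1 := by
  simp only [scalPart, LinearMap.comp_apply, LinearEquiv.coe_coe, symb_one]
  exact map_one (algebraMapInv (R := ℝ) (M := W))

theorem scalPart_algebraMap (r : ℝ) : scalPart B (algebraMap ℝ _ r) = r := by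
  simp only [scalPart, LinearMap.comp_apply, LinearEquiv.coe_coe, symb_algebraMap]
  exact algebraMapInv_algebraMap r

variable (hsymm : ∀ ξ ζ, B ξ ζ = B ζ ξ)
include hsymm

theorem symb_ι_mul (ξ : W) (y : CliffordAlgebra (halfQuad B)) :
    symb B (CliffordAlgebra.ι (halfQuad B) ξ * y) =
      ι ℝ ξ * symb B y + (1 / 2 : ℝ) • contr (B ξ) (symb B y) := by
  refine (CliffordAlgebra.changeForm_ι_mul
    CliffordAlgebra.changeForm.associated_neg_proof ξ y).trans ?_
  have h : QuadraticMap.associated (R := ℝ) (-halfQuad B) ξ = (-(1 / 2) : ℝ) • B ξ := by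
    ext ζ
    have h1 := hsymm ξ ζ
    simp [QuadraticMap.associated_apply, halfQuad, h1]
    ring
  change ι ℝ ξ * symb B y -
    contr (QuadraticMap.associated (R := ℝ) (-halfQuad B) ξ) (symb B y) = _
  rw [h, contr_smul]
  module

theorem symb_involute_mul_ι (ξ : W) (y : CliffordAlgebra (halfQuad B)) :
    symb B (CliffordAlgebra.involute y * CliffordAlgebra.ι (halfQuad B) ξ) =
      ι ℝ ξ * symb B y - (1 / 2 : ℝ) • contr (B ξ) (symb B y) := by
  induction y using CliffordAlgebra.left_induction with
  | algebraMap r =>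
    rw [AlgHom.commutes, ← Algebra.smul_def, map_smul, symb_ι, symb_algebraMap, contr_algebraMap,
      smul_zero, sub_zero, ← Algebra.commutes, Algebra.smul_def]
  | add x y hx hy =>
    rw [map_add, add_mul, map_add, hx, hy, map_add, mul_add, map_add, smul_add]
    abel
  | ι_mul x a hx =>
    rw [map_mul CliffordAlgebra.involute, CliffordAlgebra.involute_ι, neg_mul, neg_mul, mul_assoc,
      map_neg, symb_ι_mul hsymm, hx, symb_ι_mul hsymm]
    simp only [map_sub, map_add, map_smul, contr_ι_mul, mul_sub, mul_add, mul_smul_comm]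
    have h1 : contr (B a) (contr (B ξ) (symb B x)) = -contr (B ξ) (contr (B a) (symb B x)) :=
      CliffordAlgebra.contractLeft_comm _ _ _
    rw [h1, ι_mul_swap ξ a, hsymm ξ a]
    module

theorem scalPart_ι_mul (ξ : W) (y : CliffordAlgebra (halfQuad B)) :
    scalPart B (CliffordAlgebra.ι (halfQuad B) ξ * y) =
      (1 / 2 : ℝ) * algebraMapInv (contr (B ξ) (symb B y)) := by
  simp only [scalPart, LinearMap.comp_apply, LinearEquiv.coe_coe, symb_ι_mul hsymm]
  simp only [AlgHom.toLinearMap_apply, map_add, map_smul, algebraMapInv_ι_mul, zero_add,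
    smul_eq_mul]

/-- The scalar part is a graded trace. -/
theorem scalPart_involute_mul_ι (ξ : W) (y : CliffordAlgebra (halfQuad B)) :
    scalPart B (CliffordAlgebra.involute y * CliffordAlgebra.ι (halfQuad B) ξ) =
      -scalPart B (CliffordAlgebra.ι (halfQuad B) ξ * y) := by
  rw [scalPart_ι_mul hsymm]
  simp only [scalPart, LinearMap.comp_apply, LinearEquiv.coe_coe, symb_involute_mul_ι hsymm]
  simp only [AlgHom.toLinearMap_apply, map_sub, map_smul, algebraMapInv_ι_mul, zero_sub,
    smul_eq_mul]

/-- Twice the symbol of a product `a ∧ y` in terms of Clifford products. -/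
theorem symb_ι_mul_add_involute_mul_ι (ξ : W) (y : CliffordAlgebra (halfQuad B)) :
    symb B (CliffordAlgebra.ι (halfQuad B) ξ * y +
      CliffordAlgebra.involute y * CliffordAlgebra.ι (halfQuad B) ξ) =
        (2 : ℝ) • (ι ℝ ξ * symb B y) := by
  rw [map_add, symb_ι_mul hsymm, symb_involute_mul_ι hsymm]
  module

/-- Graded commutators give the interior products of the symbol. -/
theorem symb_ι_mul_sub_involute_mul_ι (ξ : W) (y : CliffordAlgebra (halfQuad B)) :
    symb B (CliffordAlgebra.ι (halfQuad B) ξ * y -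
      CliffordAlgebra.involute y * CliffordAlgebra.ι (halfQuad B) ξ) =
        contr (B ξ) (symb B y) := by
  rw [map_sub, symb_ι_mul hsymm, symb_involute_mul_ι hsymm]
  module

/-- The scalar part is the graded trace normalized at `1`. -/
theorem eq_scalPart (F : CliffordAlgebra (halfQuad B) →ₗ[ℝ] ℝ)
    (hF : ∀ ξ y, F (CliffordAlgebra.ι (halfQuad B) ξ * y +
      CliffordAlgebra.involute y * CliffordAlgebra.ι (halfQuad B) ξ) = 0) (h1 : F 1 = 1) :
    F = scalPart B := by
  have h : F ∘ₗ (symb B).symm.toLinearMap - (algebraMapInv (R := ℝ) (M := W)).toLinearMap = 0 := by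
    refine linearMap_eq_zero_of_trade _ (fun a => ⟨0, fun y => ?_⟩) ?_
    · obtain ⟨z, rfl⟩ := (symb B).surjective y
      have hz : (symb B).symm (ι ℝ a * symb B z) = (1 / 2 : ℝ) •
          (CliffordAlgebra.ι (halfQuad B) a * z +
            CliffordAlgebra.involute z * CliffordAlgebra.ι (halfQuad B) a) := by
        rw [LinearEquiv.symm_apply_eq, map_smul, symb_ι_mul_add_involute_mul_ι hsymm, smul_smul]
        norm_num
      have h0 : contr (0 : Module.Dual ℝ W) (symb B z) = 0 := by simp [contr]
      rw [h0, map_zero, LinearMap.sub_apply, LinearMap.comp_apply, LinearEquiv.coe_coe, hz,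
        map_smul, hF, AlgHom.toLinearMap_apply, algebraMapInv_ι_mul, smul_zero, sub_zero]
    · have h1' : (symb B).symm 1 = 1 := by rw [LinearEquiv.symm_apply_eq, symb_one]
      rw [LinearMap.sub_apply, LinearMap.comp_apply, LinearEquiv.coe_coe, h1', h1,
        AlgHom.toLinearMap_apply, map_one, sub_self]
  refine LinearMap.ext fun y => ?_
  have := LinearMap.congr_fun h (symb B y)
  rw [LinearMap.sub_apply, LinearMap.comp_apply, LinearEquiv.coe_coe,
    LinearEquiv.symm_apply_apply, LinearMap.zero_apply, sub_eq_zero] at this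
  exact this

theorem scalPart_involute (y : CliffordAlgebra (halfQuad B)) :
    scalPart B (CliffordAlgebra.involute y) = scalPart B y := by
  refine LinearMap.congr_fun (eq_scalPart hsymm
    (scalPart B ∘ₗ CliffordAlgebra.involute.toLinearMap) (fun ξ y => ?_) ?_) y
  · have h := scalPart_involute_mul_ι hsymm ξ (CliffordAlgebra.involute y)
    rw [CliffordAlgebra.involute_involute] at h
    simp only [LinearMap.comp_apply, AlgHom.toLinearMap_apply, map_add, map_mul,
      CliffordAlgebra.involute_ι, CliffordAlgebra.involute_involute, mul_neg, neg_mul, map_neg, h]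
    ring
  · simp only [LinearMap.comp_apply, AlgHom.toLinearMap_apply, map_one, scalPart_one]

theorem scalPart_reverse (y : CliffordAlgebra (halfQuad B)) :
    scalPart B (CliffordAlgebra.reverse y) = scalPart B y := by
  refine LinearMap.congr_fun (eq_scalPart hsymm
    (scalPart B ∘ₗ CliffordAlgebra.reverse) (fun ξ y => ?_) ?_) y
  · have h := scalPart_involute_mul_ι hsymm ξ
      (CliffordAlgebra.involute (CliffordAlgebra.reverse y))
    rw [CliffordAlgebra.involute_involute] at h
    simp only [LinearMap.comp_apply, map_add, CliffordAlgebra.reverse.map_mul,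
      CliffordAlgebra.reverse_ι, h, CliffordAlgebra.reverse_involute]
    ring
  · simp only [LinearMap.comp_apply, CliffordAlgebra.reverse.map_one, scalPart_one]

end Clifford

end ExteriorForm

/-! ### Clifford lifts of isometries -/

namespace ExteriorForm

open ExteriorAlgebra

section Lifts

variable {W : Type*} [AddCommGroup W] [Module ℝ W] {B : LinearMap.BilinForm ℝ W}

/-- The element `τ` of the Clifford algebra implements `A` by the twisted adjoint action. -/
def IsLift (B : LinearMap.BilinForm ℝ W) (A : W →ₗ[ℝ] W) (τ : CliffordAlgebra (halfQuad B)) :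
    Prop :=
  ∀ ξ, CliffordAlgebra.involute τ * CliffordAlgebra.ι (halfQuad B) ξ =
    CliffordAlgebra.ι (halfQuad B) (A ξ) * τ

theorem exists_form_eq [FiniteDimensional ℝ W] (hpos : ∀ ξ, ξ ≠ 0 → 0 < B ξ ξ)
    (d : Module.Dual ℝ W) : ∃ u, B u = d := by
  have hinj : Function.Injective (B : W →ₗ[ℝ] Module.Dual ℝ W) := by
    refine (injective_iff_map_eq_zero _).2 fun u hu => ?_
    by_contra h
    have := hpos u h
    rw [hu] at this
    simp at this
  have hfr : Module.finrank ℝ W = Module.finrank ℝ (Module.Dual ℝ W) :=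
    Subspace.dual_finrank_eq.symm
  have hsurj : Function.Surjective (B : W →ₗ[ℝ] Module.Dual ℝ W) :=
    (LinearMap.injective_iff_surjective_of_finrank_eq_finrank hfr).1 hinj
  exact hsurj d

theorem surjective_add_id [FiniteDimensional ℝ W] {A : W →ₗ[ℝ] W}
    (hA : ∀ ξ, A ξ + ξ = 0 → ξ = 0) (u : W) : ∃ ξ, A ξ + ξ = u := by
  have hinj : Function.Injective (A + LinearMap.id : W →ₗ[ℝ] W) :=
    (injective_iff_map_eq_zero _).2 fun m hm => hA m hm
  exact (LinearMap.injective_iff_surjective.1 hinj) u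

theorem scalPart_eq_zero_iff_homPart (τ : CliffordAlgebra (halfQuad B)) :
    scalPart B τ = 0 ↔ homPart 0 (symb B τ) = 0 := by
  rw [homPart_zero_eq, algebraMap_eq_zero_iff]
  rfl

variable (hsymm : ∀ ξ ζ, B ξ ζ = B ζ ξ)

include hsymm

/-- The equation satisfied by the symbol of a lift: exterior multiplication by `A ξ - ξ` acts on it
as an interior product. -/
theorem IsLift.ι_mul_symb {A : W →ₗ[ℝ] W} {τ : CliffordAlgebra (halfQuad B)} (h : IsLift B A τ)
    (ξ : W) : ι ℝ (A ξ - ξ) * symb B τ = (-(1 / 2) : ℝ) • contr (B (A ξ + ξ)) (symb B τ) := by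
  have h1 := congrArg (symb B) (h ξ)
  rw [symb_ι_mul hsymm, symb_involute_mul_ι hsymm] at h1
  rw [map_sub, sub_mul, map_add, contr_add]
  have h2 : ι ℝ (A ξ) * symb B τ - ι ℝ ξ * symb B τ =
      -((1 / 2 : ℝ) • contr (B ξ) (symb B τ)) - (1 / 2 : ℝ) • contr (B (A ξ)) (symb B τ) := by
    rw [sub_eq_sub_iff_add_eq_add, ← sub_eq_zero]
    rw [← sub_eq_zero] at h1
    rw [← neg_eq_zero, ← h1]
    abel
  rw [h2]
  module

/-- If `A` has no eigenvalue `-1`, then lifts of `A` are determined by their scalar part. -/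
theorem IsLift.eq_zero [FiniteDimensional ℝ W] (hpos : ∀ ξ, ξ ≠ 0 → 0 < B ξ ξ)
    {A : W →ₗ[ℝ] W} {τ : CliffordAlgebra (halfQuad B)} (h : IsLift B A τ)
    (hA : ∀ ξ, A ξ + ξ = 0 → ξ = 0) (h0 : scalPart B τ = 0) : τ = 0 := by
  refine (LinearEquiv.map_eq_zero_iff (symb B)).1
    (eq_zero_of_homPart_zero_eq_zero (fun d => ?_) ((scalPart_eq_zero_iff_homPart τ).1 h0))
  obtain ⟨u, rfl⟩ := exists_form_eq hpos d
  obtain ⟨ξ, rfl⟩ := surjective_add_id hA u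
  refine ⟨(-2 : ℝ) • (A ξ - ξ), ?_⟩
  rw [map_smul, smul_mul_assoc, h.ι_mul_symb hsymm, smul_smul]
  norm_num

theorem IsLift.eq_algebraMap [FiniteDimensional ℝ W] (hpos : ∀ ξ, ξ ≠ 0 → 0 < B ξ ξ)
    {τ : CliffordAlgebra (halfQuad B)} (h : IsLift B LinearMap.id τ) :
    τ = algebraMap ℝ _ (scalPart B τ) := by
  rw [← sub_eq_zero]
  refine IsLift.eq_zero hsymm hpos (A := LinearMap.id) (fun ξ => ?_) (fun ξ hξ => ?_) ?_
  · rw [map_sub, sub_mul, h ξ, AlgHom.commutes, mul_sub, LinearMap.id_apply, Algebra.commutes]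
  · rw [LinearMap.id_apply, ← two_smul ℝ, smul_eq_zero] at hξ
    exact hξ.resolve_left two_ne_zero
  · rw [map_sub, scalPart_algebraMap, sub_self]

/-- The reflection `x ↦ x - B(v, x) v`, for `B(v, v) = 2`. -/
def formReflection (B : LinearMap.BilinForm ℝ W) (v : W) : W →ₗ[ℝ] W :=
  LinearMap.transvection (B v) (-v)

omit hsymm in
theorem formReflection_apply (v x : W) : formReflection B v x = x - B v x • v := by
  simp [formReflection, LinearMap.transvection.apply, sub_eq_add_neg]

omit hsymm in
theorem formReflection_formReflection {v : W} (hv : B v v = 2) (x : W) :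
    formReflection B v (formReflection B v x) = x := by
  simp only [formReflection_apply, map_sub, map_smul, hv]
  module

theorem form_formReflection_formReflection {v : W} (hv : B v v = 2) (x y : W) :
    B (formReflection B v x) (formReflection B v y) = B x y := by
  simp only [formReflection_apply, map_sub, map_smul, hv, smul_eq_mul, LinearMap.sub_apply,
    LinearMap.smul_apply, hsymm x v]
  ring

omit hsymm in
theorem ι_mul_self_of_form_eq_two {v : W} (hv : B v v = 2) :
    CliffordAlgebra.ι (halfQuad B) v * CliffordAlgebra.ι (halfQuad B) v = 1 := by
  rw [CliffordAlgebra.ι_sq_scalar]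
  simp [halfQuad, hv]

theorem ι_mul_ι_eq_sub (v x : W) :
    CliffordAlgebra.ι (halfQuad B) v * CliffordAlgebra.ι (halfQuad B) x =
      B v x • 1 - CliffordAlgebra.ι (halfQuad B) x * CliffordAlgebra.ι (halfQuad B) v := by
  rw [eq_sub_iff_add_eq, CliffordAlgebra.ι_mul_ι_add_swap, Algebra.algebraMap_eq_smul_one]
  congr 1
  simp [halfQuad, QuadraticMap.polar, hsymm x v]
  ring

theorem IsLift.ι_mul {A : W →ₗ[ℝ] W} {τ : CliffordAlgebra (halfQuad B)} (h : IsLift B A τ)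
    {v : W} (hv : B v v = 2) :
    IsLift B (formReflection B v ∘ₗ A) (CliffordAlgebra.ι (halfQuad B) v * τ) := by
  intro ξ
  rw [map_mul, CliffordAlgebra.involute_ι, neg_mul, neg_mul, mul_assoc, h ξ, ← mul_assoc,
    ι_mul_ι_eq_sub hsymm, LinearMap.comp_apply, formReflection_apply, map_sub, map_smul,
    ← mul_assoc, sub_mul, sub_mul, sub_mul, neg_sub, smul_mul_assoc, smul_mul_assoc,
    ι_mul_self_of_form_eq_two hv, smul_mul_assoc]

theorem det_half_one_add_formReflection_comp_formReflection [FiniteDimensional ℝ W] {v w : W}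
    (hv : B v v = 2) (hw : B w w = 2) :
    LinearMap.det ((1 / 2 : ℝ) • (1 + formReflection B w ∘ₗ formReflection B v)) =
      (1 / 4) * B w v ^ 2 := by
  -- `½ (R_w + R_v)` is a product of two rank one perturbations in the orthogonal directions
  -- `w + v` and `w - v`.
  have h1 : (1 / 2 : ℝ) • (1 + formReflection B w ∘ₗ formReflection B v) =
      (LinearMap.transvection (B (w + v)) (-(1 / 4 : ℝ) • (w + v)) ∘ₗ
        LinearMap.transvection (B (w - v)) (-(1 / 4 : ℝ) • (w - v))) ∘ₗ formReflection B v := by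
    ext x
    simp only [LinearMap.smul_apply, LinearMap.add_apply, Module.End.one_apply,
      LinearMap.comp_apply, LinearMap.transvection.apply, formReflection_apply, map_add,
      map_sub, map_smul, LinearMap.sub_apply, hv, hw, hsymm v w]
    module
  rw [h1, LinearMap.det_comp, LinearMap.det_comp, formReflection, LinearMap.transvection.det,
    LinearMap.transvection.det, LinearMap.transvection.det]
  simp only [map_add, map_sub, map_smul, map_neg, LinearMap.sub_apply, LinearMap.add_apply, hv, hw,
    hsymm v w, smul_eq_mul]
  ring

/-- A symmetric endomorphism which is not the scalar `c` has an eigenvalue other than `c`. -/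
theorem exists_eigenvector_ne [FiniteDimensional ℝ W] (hpos : ∀ ξ, ξ ≠ 0 → 0 < B ξ ξ)
    (S : W →ₗ[ℝ] W) (hS : ∀ x y, B (S x) y = B x (S y)) (c : ℝ) (hc : ∃ x, S x ≠ c • x) :
    ∃ (v : W) (l : ℝ), v ≠ 0 ∧ l ≠ c ∧ S v = l • v := by
  let core : InnerProductSpace.Core ℝ W :=
    { inner := fun x y => B x y
      conj_inner_symm := fun x y => hsymm y x
      re_inner_nonneg := fun x => by
        rcases eq_or_ne x 0 with rfl | hx
        · simp
        · exact (hpos x hx).le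
      add_left := fun x y z => by simp
      smul_left := fun x y r => by simp
      definite := fun x hx => by
        by_contra h
        exact (hpos x h).ne' hx }
  let : NormedAddCommGroup W := core.toNormedAddCommGroup
  let : InnerProductSpace ℝ W := InnerProductSpace.ofCore core.toCore
  have hsym : S.IsSymmetric := fun x y => hS x y
  by_contra! hno
  obtain ⟨x, hx⟩ := hc
  apply hx
  let b := hsym.eigenvectorBasis rfl
  have hb : ∀ i, S (b i) = c • b i := by
    intro i
    have h1 := hsym.apply_eigenvectorBasis rfl i
    have h2 : hsym.eigenvalues rfl i = c := by
      by_contra h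
      exact hno (b i) _ (b.orthonormal.ne_zero i) h h1
    rw [h2] at h1
    exact h1
  have : S = c • LinearMap.id := b.toBasis.ext fun i => by
    simpa using hb i
  rw [this]
  simp

end Lifts

end ExteriorForm

/-! ### The scalar part of a lift -/

namespace ExteriorForm

open ExteriorAlgebra

section Magnitude

variable {W : Type*} [AddCommGroup W] [Module ℝ W] [FiniteDimensional ℝ W]
  {B : LinearMap.BilinForm ℝ W}

/-- An isometry `A ≠ 1` without eigenvalue `-1` agrees on some invariant plane with a product of
two reflections; splitting off that product leaves an isometry with more fixed vectors. -/
theorem exists_reflections_split (hsymm : ∀ ξ ζ, B ξ ζ = B ζ ξ) (hpos : ∀ ξ, ξ ≠ 0 → 0 < B ξ ξ)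
    {A : W →ₗ[ℝ] W} (hiso : ∀ x y, B (A x) (A y) = B x y) (hA : ∀ ξ, A ξ + ξ = 0 → ξ = 0)
    (hne : A ≠ LinearMap.id) :
    ∃ v w : W, B v v = 2 ∧ B w w = 2 ∧
      let A' := formReflection B v ∘ₗ formReflection B w ∘ₗ A
      A' v = v ∧ A' w = w ∧ A v ≠ v ∧ (∀ x, A x = x → A' x = x) ∧
        ∀ ξ, A' ξ + ξ = 0 → ξ = 0 := by
  have hinj : Function.Injective A := (injective_iff_map_eq_zero _).2 fun x hx => by
    by_contra h
    have h1 := hpos x h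
    rw [← hiso, hx] at h1
    simp at h1
  let e := LinearEquiv.ofInjectiveEndo A hinj
  have he : ∀ x, A (e.symm x) = x := fun x => LinearEquiv.apply_symm_apply e x
  have he' : ∀ x, e.symm (A x) = x := fun x => LinearEquiv.symm_apply_apply e x
  have hadj : ∀ x y, B (e.symm x) y = B x (A y) := fun x y => by rw [← hiso, he]
  have hadj' : ∀ x y, B (A x) y = B x (e.symm y) := fun x y => by rw [← hiso x, he]
  -- `A + A⁻¹` is symmetric; it equals `2` only for `A = 1`.
  obtain ⟨v₀, l, hv₀, hl, hev₀⟩ := exists_eigenvector_ne hsymm hpos (A + e.symm.toLinearMap)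
    (fun x y => by
      simp only [LinearMap.add_apply, map_add, LinearEquiv.coe_coe, hadj, hadj']
      ring) 2 (by
      by_contra! hall
      apply hne
      ext x
      have hx : A x + e.symm x = (2 : ℝ) • x := hall x
      have h0 : B (A x - x) (A x - x) = 0 := by
        have h1 : B (A x + e.symm x) x = 2 * B x x := by rw [hx]; simp
        simp only [map_add, LinearMap.add_apply, hadj, hsymm x (A x)] at h1
        simp only [map_sub, LinearMap.sub_apply, hiso, hsymm x (A x)]
        linarith
      by_contra h
      exact (hpos _ (sub_ne_zero.2 h)).ne' h0)
  have hpv := hpos v₀ hv₀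
  -- The eigenvector `v`, normalized to `B v v = 2`.
  set v := √(2 / B v₀ v₀) • v₀ with hvdef
  have hvv : B v v = 2 := by
    have : √(2 / B v₀ v₀) * √(2 / B v₀ v₀) = 2 / B v₀ v₀ := Real.mul_self_sqrt (by positivity)
    simp only [hvdef, map_smul, LinearMap.smul_apply, smul_eq_mul]
    rw [← mul_assoc, this]
    field_simp
  have hev : A v + e.symm v = l • v := by
    have h1 : A v₀ + e.symm v₀ = l • v₀ := hev₀
    simp only [hvdef, map_smul]
    rw [← smul_add, h1, smul_comm]
  clear_value v
  have hAA : A (A v) = l • A v - v := by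
    have := congrArg A hev
    rw [map_add, he, map_smul] at this
    rw [← this]; abel
  have hlv : B (A v) v = l := by
    have h1 : B (A v + e.symm v) v = l * 2 := by rw [hev]; simp [hvv]
    simp only [map_add, LinearMap.add_apply, hadj, hsymm v (A v)] at h1
    linarith
  have hvne : v ≠ 0 := by
    intro h; rw [h] at hvv; simp at hvv
  set u := v + A v with hu
  have hune : u ≠ 0 := by
    intro h
    exact hvne (hA v (by rw [← h, hu]; abel))
  have huu : B u u = 4 + 2 * l := by
    simp only [hu, map_add, LinearMap.add_apply, hiso, hvv, hlv, hsymm v (A v)]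
    ring
  have hl2 : 0 < 2 + l := by
    have := hpos u hune
    rw [huu] at this
    linarith
  -- With `w` proportional to `v + A v`, the product of the reflections in `v` and `w` undoes `A` on
  -- the plane spanned by `v` and `A v`.
  set s := √(1 / (2 + l)) with hs
  have hss : s * s = 1 / (2 + l) := Real.mul_self_sqrt (by positivity)
  have hwu : ∀ x, formReflection B (s • u) x = x - (B u x / (2 + l)) • u := by
    intro x
    rw [formReflection_apply, map_smul, LinearMap.smul_apply, smul_smul, smul_eq_mul]
    congr 2
    calc s * B u x * s = (s * s) * B u x := by ring
      _ = B u x / (2 + l) := by rw [hss]; ring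
  have hBuv : B u v = 2 + l := by
    simp only [hu, map_add, LinearMap.add_apply, hvv, hlv]
  have hBuAv : B u (A v) = 2 + l := by
    simp only [hu, map_add, LinearMap.add_apply, hiso, hvv, hsymm v (A v), hlv]
    ring
  have hAv : formReflection B v (formReflection B (s • u) (A v)) = v := by
    rw [hwu, hBuAv, div_self hl2.ne', one_smul, formReflection_apply]
    simp only [hu, map_sub, map_add, hvv, hsymm v (A v), hlv]
    module
  have hAAv : formReflection B v (formReflection B (s • u) (A (A v))) = A v := by
    rw [hAA, map_sub, map_smul, hwu, hwu, hBuAv, hBuv, div_self hl2.ne', one_smul,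
      formReflection_apply]
    simp only [hu, map_sub, map_add, map_smul, hvv, hsymm v (A v), hlv, smul_eq_mul]
    module
  have hww : B (s • u) (s • u) = 2 := by
    simp only [map_smul, LinearMap.smul_apply, smul_eq_mul, huu]
    rw [← mul_assoc, hss]
    field_simp
    ring
  -- Vectors orthogonal to the plane are not moved by the two reflections.
  have hperp : ∀ x, B v x = 0 → B (A v) x = 0 →
      formReflection B v (formReflection B (s • u) x) = x := by
    intro x h1 h2
    have h3 : B u x = 0 := by simp only [hu, map_add, LinearMap.add_apply, h1, h2, add_zero]
    rw [hwu, h3, zero_div, zero_smul, sub_zero, formReflection_apply, h1, zero_smul, sub_zero]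
  refine ⟨v, s • u, hvv, hww, ?_, ?_, ?_, ?_, ?_⟩
  · exact hAv
  · have hAu : formReflection B v (formReflection B (s • u) (A u)) = u := by
      simp only [hu, map_add] at hAv hAAv ⊢
      rw [hAv, hAAv]
    simp only [LinearMap.comp_apply]
    rw [map_smul, map_smul, map_smul, hAu]
  · intro h
    apply hl
    rw [h, hvv] at hlv
    exact hlv.symm
  · intro x hx
    have h1 : B v x = 0 := by
      have h2 : B (A v + e.symm v) x = l * B v x := by rw [hev]; simp
      simp only [map_add, LinearMap.add_apply, hadj, hx] at h2
      rw [show B (A v) x = B v x by conv_lhs => rw [← hx, hiso]] at h2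
      have : (2 - l) * B v x = 0 := by linarith
      exact (mul_eq_zero.1 this).resolve_left (sub_ne_zero.2 (Ne.symm hl))
    have h2 : B (A v) x = 0 := by rw [← h1, ← hiso v x, hx]
    simp only [LinearMap.comp_apply]
    rw [hx, hperp x h1 h2]
  · intro x hx
    simp only [LinearMap.comp_apply] at hx
    have hiso' : ∀ x y, B (formReflection B v (formReflection B (s • u) (A x)))
        (formReflection B v (formReflection B (s • u) (A y))) = B x y := fun x y => by
      rw [form_formReflection_formReflection hsymm hvv,
        form_formReflection_formReflection hsymm hww, hiso]
    rw [add_eq_zero_iff_eq_neg] at hx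
    have h1 : B v x = 0 := by
      have := hiso' v x
      rw [hAv, hx, map_neg] at this
      linarith
    have h2 : B (A v) x = 0 := by
      have := hiso' (A v) x
      rw [hAAv, hx, map_neg] at this
      linarith
    refine hA x ?_
    have h3 := congrArg (fun z => formReflection B (s • u) (formReflection B v z)) hx
    simp only [formReflection_formReflection hvv, formReflection_formReflection hww] at h3
    have h4 := hperp x h1 h2
    have h5 := congrArg (fun z => formReflection B (s • u) (formReflection B v z)) h4
    simp only [formReflection_formReflection hvv, formReflection_formReflection hww] at h5
    rw [h3, map_neg, map_neg, ← h5]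
    simp

/-- The square of the scalar part of a normalized lift of `A` is `det ((1 + A) / 2)`. -/
theorem IsLift.scalPart_sq (hsymm : ∀ ξ ζ, B ξ ζ = B ζ ξ) (hpos : ∀ ξ, ξ ≠ 0 → 0 < B ξ ξ)
    {A : W →ₗ[ℝ] W} (hiso : ∀ x y, B (A x) (A y) = B x y) (hA : ∀ ξ, A ξ + ξ = 0 → ξ = 0)
    {τ : CliffordAlgebra (halfQuad B)} (h : IsLift B A τ)
    (hτ : CliffordAlgebra.reverse τ * τ = 1) :
    scalPart B τ ^ 2 = LinearMap.det ((1 / 2 : ℝ) • (1 + A)) := by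
  induction hn : Module.finrank ℝ W - Module.finrank ℝ (LinearMap.ker (A - LinearMap.id))
    using Nat.strong_induction_on generalizing A τ with
  | _ n ih =>
    by_cases hid : A = LinearMap.id
    · subst hid
      have h1 := h.eq_algebraMap hsymm hpos
      rw [h1, CliffordAlgebra.reverse.commutes, ← map_mul] at hτ
      have h2 := congrArg (scalPart B) hτ
      rw [scalPart_algebraMap, scalPart_one] at h2
      have h3 : (1 / 2 : ℝ) • (1 + (LinearMap.id : W →ₗ[ℝ] W)) = LinearMap.id := by
        ext x
        simp only [LinearMap.smul_apply, LinearMap.add_apply, Module.End.one_apply,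
          LinearMap.id_apply]
        module
      rw [h3, LinearMap.det_id, pow_two, h2]
    · obtain ⟨v, w, hv, hw, hA'v, hA'w, hAv, hfix, hA'⟩ :=
        exists_reflections_split hsymm hpos hiso hA hid
      set A' := formReflection B v ∘ₗ formReflection B w ∘ₗ A with hA'def
      set τ' := CliffordAlgebra.ι (halfQuad B) v * (CliffordAlgebra.ι (halfQuad B) w * τ)
        with hτ'def
      have hl' : IsLift B A' τ' := (h.ι_mul hsymm hw).ι_mul hsymm hv
      have hvv := ι_mul_self_of_form_eq_two hv
      have hww := ι_mul_self_of_form_eq_two hw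
      have hττ' : τ = CliffordAlgebra.ι (halfQuad B) w *
          (CliffordAlgebra.ι (halfQuad B) v * τ') := by
        rw [hτ'def, ← mul_assoc (CliffordAlgebra.ι (halfQuad B) v), hvv, one_mul, ← mul_assoc,
          hww, one_mul]
      have hiso' : ∀ x y, B (A' x) (A' y) = B x y := fun x y => by
        simp only [hA'def, LinearMap.comp_apply]
        rw [form_formReflection_formReflection hsymm hv,
          form_formReflection_formReflection hsymm hw, hiso]
      have hlt : LinearMap.ker (A - LinearMap.id) < LinearMap.ker (A' - LinearMap.id) := by
        refine lt_of_le_of_ne (fun x hx => ?_) fun he => ?_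
        · rw [LinearMap.mem_ker, LinearMap.sub_apply, sub_eq_zero] at hx ⊢
          exact hfix x hx
        · have : v ∈ LinearMap.ker (A - LinearMap.id) := by
            rw [he, LinearMap.mem_ker, LinearMap.sub_apply, sub_eq_zero]
            exact hA'v
          rw [LinearMap.mem_ker, LinearMap.sub_apply, sub_eq_zero] at this
          exact hAv this
      have hdim := Submodule.finrank_lt_finrank_of_lt hlt
      have hdim' := Submodule.finrank_le (LinearMap.ker (A' - LinearMap.id))
      have hrev : CliffordAlgebra.reverse τ' * τ' = 1 := by
        rw [hτ'def, CliffordAlgebra.reverse.map_mul, CliffordAlgebra.reverse.map_mul,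
          CliffordAlgebra.reverse_ι, CliffordAlgebra.reverse_ι, mul_assoc,
          ← mul_assoc (CliffordAlgebra.ι (halfQuad B) v), hvv, one_mul, mul_assoc,
          ← mul_assoc (CliffordAlgebra.ι (halfQuad B) w), hww, one_mul, hτ]
      have hih := ih _ (by omega) hiso' hA' hl' hrev rfl
      -- The symbol of `τ'` only involves directions orthogonal to `v` and `w`.
      have hcontr : ∀ x, A' x = x → contr (B x) (symb B τ') = 0 := by
        intro x hx
        have h1 := hl'.ι_mul_symb hsymm x
        rw [hx, sub_self, map_zero, zero_mul, ← two_smul ℝ x, map_smul, contr_smul, smul_smul]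
          at h1
        simpa using h1
      have hscal : scalPart B τ = (1 / 2) * B w v * scalPart B τ' := by
        rw [hττ', scalPart_ι_mul hsymm, symb_ι_mul hsymm, hcontr v hA'v, smul_zero, add_zero,
          contr_ι_mul, hcontr w hA'w, mul_zero, sub_zero, map_smul, smul_eq_mul, ← mul_assoc]
        rfl
      have hcomp : (1 / 2 : ℝ) • (1 + A) =
          ((1 / 2 : ℝ) • (1 + formReflection B w ∘ₗ formReflection B v)) ∘ₗ
            ((1 / 2 : ℝ) • (1 + A')) := by
        ext x
        have hAx : formReflection B w (formReflection B v (A' x)) = A x := by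
          simp only [hA'def, LinearMap.comp_apply]
          rw [formReflection_formReflection hv, formReflection_formReflection hw]
        have horth : ∀ z, A' z = z → B z (A' x - x) = 0 := by
          intro z hz
          have := hiso' z x
          rw [hz] at this
          rw [map_sub, this, sub_self]
        have hfix' : formReflection B w (formReflection B v (A' x - x)) = A' x - x := by
          rw [formReflection_apply v, horth v hA'v, zero_smul, sub_zero, formReflection_apply,
            horth w hA'w, zero_smul, sub_zero]
        rw [map_sub, map_sub, hAx] at hfix'
        have h1 : formReflection B w (formReflection B v x) = A x - A' x + x := by
          rw [← sub_eq_zero] at hfix' ⊢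
          rw [← neg_eq_zero, ← hfix']
          abel
        simp only [LinearMap.smul_apply, LinearMap.add_apply, Module.End.one_apply,
          LinearMap.comp_apply, map_smul, map_add, hAx, h1]
        module
      rw [hcomp, LinearMap.det_comp, ← hih, det_half_one_add_formReflection_comp_formReflection
        hsymm hv hw, hscal]
      ring

end Magnitude

end ExteriorForm

/-! ### The tangent space of a group valued Hamiltonian manifold -/

namespace ExteriorForm

open ExteriorAlgebra

/-- The linear data at a point `m` of a group valued Hamiltonian manifold: the 2-form `β` on the
tangent space `V`, the right-trivialized derivative `μ` of the moment map, the infinitesimal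
action `a` and the isometry `A` of the Lie algebra `W`. -/
structure HamiltonianPoint {V W : Type*} [AddCommGroup V] [Module ℝ V] [TopologicalSpace V]
    [AddCommGroup W] [Module ℝ W] (B : LinearMap.BilinForm ℝ W) (A : W →ₗ[ℝ] W)
    (β : V [⋀^Fin 2]→L[ℝ] ℝ) (μ : V →ₗ[ℝ] W) (a : W →ₗ[ℝ] V) : Prop where
  symm : ∀ ξ ζ, B ξ ζ = B ζ ξ
  pos : ∀ ξ, ξ ≠ 0 → 0 < B ξ ξ
  isometry : ∀ ξ ζ, B (A ξ) (A ζ) = B ξ ζ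
  moment : ∀ ξ v, β ![a ξ, v] = (1 / 2) * B (μ v) (A ξ + ξ)
  map_action : ∀ ξ, μ (a ξ) = A ξ - ξ
  ker : ∀ v, (∀ w, β ![v, w] = 0) → ∃ ξ, A ξ + ξ = 0 ∧ v = a ξ
  ker' : ∀ ξ, A ξ + ξ = 0 → ∀ w, β ![a ξ, w] = 0

namespace HamiltonianPoint

section HalfDual

variable {V W : Type*} [AddCommGroup V] [Module ℝ V] [AddCommGroup W] [Module ℝ W]
  {B : LinearMap.BilinForm ℝ W} {μ : V →ₗ[ℝ] W}

/-- The map `ξ ↦ ½ B(ξ, μ ·)` replacing the generators of `⋀ W` by 1-forms on `V`. -/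
def halfDual (B : LinearMap.BilinForm ℝ W) (μ : V →ₗ[ℝ] W) : W →ₗ[ℝ] Module.Dual ℝ V :=
  (1 / 2 : ℝ) • LinearMap.compl₂ B μ

@[simp]
theorem halfDual_apply (ξ : W) (v : V) : halfDual B μ ξ v = (1 / 2) * B ξ (μ v) := by
  simp [halfDual]

theorem contrVec_map_halfDual (hsymm : ∀ ξ ζ, B ξ ζ = B ζ ξ) (v : V) (x : ExteriorAlgebra ℝ W) :
    contrVec v (ExteriorAlgebra.map (halfDual B μ) x) =
      ExteriorAlgebra.map (halfDual B μ) ((1 / 2 : ℝ) • contr (B (μ v)) x) := by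
  have h : (Module.Dual.eval ℝ V v) ∘ₗ halfDual B μ = (1 / 2 : ℝ) • B (μ v) := by
    ext ξ
    simp [hsymm ξ]
  rw [contrVec, contr_map, h, contr_smul]

end HalfDual

variable {V W : Type*} [AddCommGroup V] [Module ℝ V] [TopologicalSpace V]
  [AddCommGroup W] [Module ℝ W] {B : LinearMap.BilinForm ℝ W} {A : W →ₗ[ℝ] W}
  {β : V [⋀^Fin 2]→L[ℝ] ℝ} {μ : V →ₗ[ℝ] W} {a : W →ₗ[ℝ] V}
  (H : HamiltonianPoint B A β μ a)
include H

/-- Where `β` is nondegenerate, `A` has no eigenvalue `-1`. -/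
theorem eq_zero_of_nondegenerate (hnd : ∀ v, (∀ w, β ![v, w] = 0) → v = 0) (ξ : W)
    (hξ : A ξ + ξ = 0) : ξ = 0 := by
  have h1 := hnd (a ξ) (H.ker' ξ hξ)
  have h2 := H.map_action ξ
  rw [h1, map_zero, eq_comm, sub_eq_zero] at h2
  rw [h2, ← two_smul ℝ, smul_eq_zero] at hξ
  exact hξ.resolve_left two_ne_zero

/-- The pull-back of the symbol of a lift under `μ` does not vanish. -/
theorem map_halfDual_symb_ne_zero [FiniteDimensional ℝ W] {τ : CliffordAlgebra (halfQuad B)}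
    (hτ : IsLift B A τ)
    (h0 : τ ≠ 0) : ExteriorAlgebra.map (halfDual B μ) (symb B τ) ≠ 0 := by
  intro h
  refine h0 ((LinearEquiv.map_eq_zero_iff (symb B)).1
    (eq_zero_of_map_eq_zero _ _ (fun k hk hk0 => ⟨B k, ?_, (H.pos k hk0).ne'⟩) h))
  -- A vector orthogonal to the range of `μ` is fixed by `A`, as `A ζ - ζ = μ (a ζ)`.
  have hk' : ∀ v, B k (μ v) = 0 := by
    intro v
    have := LinearMap.congr_fun hk v
    rw [halfDual_apply, LinearMap.zero_apply] at this
    linarith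
  have hAk : A k = k := by
    by_contra hne
    have h1 := H.pos _ (sub_ne_zero.2 hne)
    have h2 := hk' (a k)
    rw [H.map_action, map_sub] at h2
    simp only [map_sub, LinearMap.sub_apply, H.isometry, H.symm (A k) k] at h1
    linarith
  have h3 := hτ.ι_mul_symb H.symm k
  rw [hAk, sub_self, map_zero, zero_mul, ← two_smul ℝ k, map_smul, contr_smul, smul_smul] at h3
  simpa using h3

variable [FiniteDimensional ℝ V] [FiniteDimensional ℝ W]

/-- The covectors by which vectors `v` with `μ v = A ξ + ξ` act on `exp β ∧ μ^* 𝒯` exhaust `V*`: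
they form a linear family of dimension `dim V` on which no nonzero member vanishes. -/
theorem exists_vec_of_covector (α : Module.Dual ℝ V) :
    ∃ (v : V) (ξ : W), μ v = A ξ + ξ ∧ twoFormFlat β v - halfDual B μ (A ξ - ξ) = α := by
  let P : V × W →ₗ[ℝ] W := μ ∘ₗ LinearMap.fst ℝ V W - (A + LinearMap.id) ∘ₗ LinearMap.snd ℝ V W
  let F : V × W →ₗ[ℝ] Module.Dual ℝ V := twoFormFlat β ∘ₗ LinearMap.fst ℝ V W -
    halfDual B μ ∘ₗ (A - LinearMap.id) ∘ₗ LinearMap.snd ℝ V W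
  have hP : Function.Surjective P := by
    intro ζ
    refine ⟨(a ((-(1 / 2) : ℝ) • ζ), (-(1 / 2) : ℝ) • ζ), ?_⟩
    simp only [P, LinearMap.sub_apply, LinearMap.comp_apply, LinearMap.fst_apply,
      LinearMap.snd_apply, LinearMap.add_apply, LinearMap.id_apply, H.map_action]
    module
  have hdim : Module.finrank ℝ (LinearMap.ker P) = Module.finrank ℝ (Module.Dual ℝ V) := by
    have h1 := LinearMap.finrank_range_add_finrank_ker P
    rw [LinearMap.range_eq_top.2 hP, finrank_top, Module.finrank_prod] at h1
    rw [Subspace.dual_finrank_eq]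
    omega
  have hinj : Function.Injective (F.domRestrict (LinearMap.ker P)) := by
    refine (injective_iff_map_eq_zero _).2 ?_
    rintro ⟨⟨v, ξ⟩, hx⟩ hF
    have hμ : μ v = A ξ + ξ := by
      have : μ v - (A ξ + ξ) = 0 := hx
      exact sub_eq_zero.1 this
    have hF' : ∀ w, β ![v, w] = (1 / 2) * B (A ξ - ξ) (μ w) := by
      intro w
      have h1 : F (v, ξ) = 0 := hF
      have h2 : twoFormFlat β v w - halfDual B μ (A ξ - ξ) w = 0 := LinearMap.congr_fun h1 w
      rw [twoFormFlat_apply, halfDual_apply] at h2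
      linarith
    have hξ : ξ = 0 := by
      by_contra h
      have h1 := hF' (a ξ)
      rw [alt_two_swap, H.moment, hμ, H.map_action] at h1
      simp only [map_add, map_sub, LinearMap.add_apply, LinearMap.sub_apply, H.isometry,
        H.symm ξ (A ξ)] at h1
      have := H.pos ξ h
      linarith
    subst hξ
    have hv : ∀ w, β ![v, w] = 0 := fun w => by rw [hF' w]; simp
    obtain ⟨η, hη, rfl⟩ := H.ker v hv
    rw [H.map_action, map_zero, add_zero] at hμ
    have h2 : (2 : ℝ) • η = 0 := by
      rw [two_smul]
      nth_rw 1 [← sub_eq_zero.1 hμ]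
      exact hη
    have h3 : η = 0 := (smul_eq_zero.1 h2).resolve_left two_ne_zero
    subst h3
    simp
  obtain ⟨⟨⟨v, ξ⟩, hx⟩, hv⟩ :=
    (LinearMap.injective_iff_surjective_of_finrank_eq_finrank hdim).1 hinj α
  refine ⟨v, ξ, ?_, hv⟩
  have : μ v - (A ξ + ξ) = 0 := hx
  exact sub_eq_zero.1 this

/-- The mixed-degree form `exp β ∧ μ^* 𝒯` does not vanish, and every covector acts on it as an
interior product, so its top degree part does not vanish either. -/
theorem formPartAlg_ne_zero {τ : CliffordAlgebra (halfQuad B)} (hτ : IsLift B A τ)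
    (h0 : τ ≠ 0) :
    formPartAlg (Module.finrank ℝ V)
      (expTwoForm β * ExteriorAlgebra.map (halfDual B μ) (symb B τ)) ≠ 0 := by
  intro h
  refine H.map_halfDual_symb_ne_zero hτ h0 ?_
  refine (isUnit_expTwoForm β).mul_right_eq_zero.1
    (eq_zero_of_homPart_finrank_eq_zero (fun α => ?_) ?_)
  · obtain ⟨v, ξ, hv, rfl⟩ := H.exists_vec_of_covector α
    refine ⟨Module.Dual.eval ℝ V v, ?_⟩
    change _ = contrVec v _
    rw [contrVec_expTwoForm_mul, contrVec_map_halfDual H.symm, hv]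
    have h1 := hτ.ι_mul_symb H.symm ξ
    have h2 : (1 / 2 : ℝ) • contr (B (A ξ + ξ)) (symb B τ) = -(ι ℝ (A ξ - ξ) * symb B τ) := by
      rw [h1]; module
    rw [h2, map_neg, map_mul, map_apply_ι, mul_neg, map_sub, sub_mul, sub_eq_add_neg,
      expTwoForm_mul_ι_mul]
  · rw [Subspace.dual_finrank_eq]
    exact homPart_eq_zero_of_formPartAlg h

/-- Where `β` is nondegenerate, the top degree part of `exp β ∧ μ^* 𝒯` is the one of `exp β`
divided by the scalar part of `τ`. -/
theorem scalPart_smul_formPartAlg (hA : ∀ ξ, A ξ + ξ = 0 → ξ = 0)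
    {τ : CliffordAlgebra (halfQuad B)} (hτ : IsLift B A τ) (hpar : CliffordAlgebra.involute τ = τ)
    (hrev : CliffordAlgebra.reverse τ * τ = 1) (hrev' : τ * CliffordAlgebra.reverse τ = 1) :
    scalPart B τ • formPartAlg (Module.finrank ℝ V)
      (expTwoForm β * ExteriorAlgebra.map (halfDual B μ) (symb B τ)) =
      formPartAlg (Module.finrank ℝ V) (expTwoForm β) := by
  ext v
  -- The functional `L` and the functional `y ↦ scal (y τ⁻¹)` satisfy the same exchange relation.
  let L : CliffordAlgebra (halfQuad B) →ₗ[ℝ] ℝ := formPartLin V _ v ∘ₗ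
    LinearMap.mulLeft ℝ (expTwoForm β) ∘ₗ (ExteriorAlgebra.map (halfDual B μ)).toLinearMap ∘ₗ
      (symb B).toLinearMap
  let R : CliffordAlgebra (halfQuad B) →ₗ[ℝ] ℝ :=
    scalPart B ∘ₗ LinearMap.mulRight ℝ (CliffordAlgebra.reverse τ)
  have hL : ∀ y, L y = formPartAlg (Module.finrank ℝ V)
      (expTwoForm β * ExteriorAlgebra.map (halfDual B μ) (symb B y)) v := fun y => rfl
  have hR : ∀ y, R y = scalPart B (y * CliffordAlgebra.reverse τ) := fun y => rfl
  have hLrel : ∀ ξ y, L (CliffordAlgebra.ι (halfQuad B) (A ξ + ξ) * y) =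
      L (CliffordAlgebra.ι (halfQuad B) ξ * y -
        CliffordAlgebra.involute y * CliffordAlgebra.ι (halfQuad B) ξ) := by
    intro ξ y
    rw [hL, hL, symb_ι_mul_sub_involute_mul_ι H.symm, symb_ι_mul H.symm, ← sub_eq_zero,
      ← AlternatingMap.sub_apply]
    have hflat : twoFormFlat β (a ξ) = halfDual B μ (A ξ + ξ) := by
      ext w
      rw [twoFormFlat_apply, halfDual_apply, H.moment, H.symm]
    have h1 := contrVec_expTwoForm_mul β (a ξ)
      (ExteriorAlgebra.map (halfDual B μ) (symb B y))
    rw [contrVec_map_halfDual H.symm, H.map_action, hflat] at h1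
    have h2 : expTwoForm β * ExteriorAlgebra.map (halfDual B μ)
          (ι ℝ (A ξ + ξ) * symb B y + (1 / 2 : ℝ) • contr (B (A ξ + ξ)) (symb B y)) -
        expTwoForm β * ExteriorAlgebra.map (halfDual B μ) (contr (B ξ) (symb B y)) =
        contrVec (a ξ) (expTwoForm β * ExteriorAlgebra.map (halfDual B μ) (symb B y)) := by
      rw [h1, ← expTwoForm_mul_ι_mul, ← map_apply_ι, ← map_mul, ← mul_add, ← map_add, ← mul_sub,
        ← map_sub]
      congr 2
      simp only [contr, map_add, map_sub, LinearMap.add_apply, LinearMap.sub_apply]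
      module
    have h3 : formPartAlg (Module.finrank ℝ V)
        (contrVec (a ξ) (expTwoForm β * ExteriorAlgebra.map (halfDual B μ) (symb B y))) = 0 := by
      refine formPartAlg_of_homPart_eq_zero ?_
      rw [← contr_homPart_succ, homPart_eq_zero_of_finrank_lt, map_zero]
      rw [Subspace.dual_finrank_eq]; omega
    rw [← h2] at h3
    have h4 := congrArg (fun f => f v) h3
    simp only [← formPartLin_apply, map_sub] at h4 ⊢
    exact h4
  have hRrel : ∀ ξ y, R (CliffordAlgebra.ι (halfQuad B) (A ξ + ξ) * y) =
      R (CliffordAlgebra.ι (halfQuad B) ξ * y -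
        CliffordAlgebra.involute y * CliffordAlgebra.ι (halfQuad B) ξ) := by
    intro ξ y
    have hcomm : CliffordAlgebra.ι (halfQuad B) ξ * CliffordAlgebra.reverse τ =
        CliffordAlgebra.reverse τ * CliffordAlgebra.ι (halfQuad B) (A ξ) := by
      have h1 := hτ ξ
      rw [hpar] at h1
      calc CliffordAlgebra.ι (halfQuad B) ξ * CliffordAlgebra.reverse τ
          = CliffordAlgebra.reverse τ * (τ * CliffordAlgebra.ι (halfQuad B) ξ) *
            CliffordAlgebra.reverse τ := by rw [← mul_assoc, hrev, one_mul]
        _ = CliffordAlgebra.reverse τ * CliffordAlgebra.ι (halfQuad B) (A ξ) := by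
            rw [h1, mul_assoc, mul_assoc, hrev', mul_one]
    have hparr : CliffordAlgebra.involute (CliffordAlgebra.reverse τ) =
        CliffordAlgebra.reverse τ := by
      rw [← CliffordAlgebra.reverse_involute, hpar]
    have h2 := scalPart_involute_mul_ι H.symm (A ξ) (y * CliffordAlgebra.reverse τ)
    rw [map_mul CliffordAlgebra.involute, hparr, mul_assoc, ← hcomm] at h2
    rw [hR, hR, sub_mul, map_sub, mul_assoc (CliffordAlgebra.involute y), h2, map_add, add_mul,
      add_mul, map_add, mul_assoc _ y]
    ring
  let G : CliffordAlgebra (halfQuad B) →ₗ[ℝ] ℝ := R 1 • L - L 1 • R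
  have hGrel : ∀ ξ y, G (CliffordAlgebra.ι (halfQuad B) (A ξ + ξ) * y) =
      G (CliffordAlgebra.ι (halfQuad B) ξ * y -
        CliffordAlgebra.involute y * CliffordAlgebra.ι (halfQuad B) ξ) := by
    intro ξ y
    simp only [G, LinearMap.sub_apply, LinearMap.smul_apply, hLrel, hRrel]
  have hG : G ∘ₗ (symb B).symm.toLinearMap = 0 := by
    refine linearMap_eq_zero_of_trade _ (fun b => ?_) ?_
    · obtain ⟨ξ, rfl⟩ := surjective_add_id hA b
      refine ⟨B ξ + (-(1 / 2) : ℝ) • B (A ξ + ξ), fun x => ?_⟩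
      obtain ⟨y, rfl⟩ := (symb B).surjective x
      have h1 := hGrel ξ y
      rw [← (symb B).symm_apply_apply (CliffordAlgebra.ι (halfQuad B) (A ξ + ξ) * y),
        ← (symb B).symm_apply_apply (CliffordAlgebra.ι (halfQuad B) ξ * y - _),
        symb_ι_mul_sub_involute_mul_ι H.symm, symb_ι_mul H.symm] at h1
      rw [contr_add, contr_smul]
      simp only [LinearMap.comp_apply, LinearEquiv.coe_coe, map_add, map_smul] at h1 ⊢
      rw [← h1]
      module
    · have h1' : (symb B).symm 1 = 1 := by rw [LinearEquiv.symm_apply_eq, symb_one]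
      rw [LinearMap.comp_apply, LinearEquiv.coe_coe, h1']
      simp only [G, LinearMap.sub_apply, LinearMap.smul_apply, smul_eq_mul]
      ring
  have hGτ : G τ = 0 := by
    have := LinearMap.congr_fun hG (symb B τ)
    rwa [LinearMap.comp_apply, LinearEquiv.coe_coe, LinearEquiv.symm_apply_apply] at this
  simp only [G, LinearMap.sub_apply, LinearMap.smul_apply, smul_eq_mul] at hGτ
  rw [hR, hR, hrev', scalPart_one, one_mul, scalPart_reverse H.symm, hL, hL, symb_one, map_one,
    mul_one, mul_one, sub_eq_zero] at hGτ
  rw [AlternatingMap.smul_apply, smul_eq_mul, hGτ]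

end HamiltonianPoint

end ExteriorForm

/-! ### Derivatives on Lie groups and the infinitesimal moment map condition -/

namespace ExteriorForm

section Derivatives

variable {E : Type*} [NormedAddCommGroup E] [NormedSpace ℝ E]
  {M : Type*} [TopologicalSpace M] [ChartedSpace E M]
  {E' : Type*} [NormedAddCommGroup E'] [NormedSpace ℝ E']
  {M' : Type*} [TopologicalSpace M'] [ChartedSpace E' M']
  {E'' : Type*} [NormedAddCommGroup E''] [NormedSpace ℝ E'']
  {M'' : Type*} [TopologicalSpace M''] [ChartedSpace E'' M'']

/-- The manifold derivative, as a map between the model spaces with which the tangent spaces are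
identified; its type does not depend on the base points. -/
def mder (E E' : Type*) [NormedAddCommGroup E] [NormedSpace ℝ E] [NormedAddCommGroup E']
    [NormedSpace ℝ E'] {M M' : Type*} [TopologicalSpace M] [ChartedSpace E M] [TopologicalSpace M']
    [ChartedSpace E' M'] (f : M → M') (x : M) : E →L[ℝ] E' :=
  mfderiv 𝓘(ℝ, E) 𝓘(ℝ, E') f x

theorem mder_comp {g : M' → M''} {f : M → M'} {x : M} {y : M'} (hy : f x = y)
    (hg : MDifferentiableAt 𝓘(ℝ, E') 𝓘(ℝ, E'') g y) (hf : MDifferentiableAt 𝓘(ℝ, E) 𝓘(ℝ, E') f x) :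
    mder E E'' (fun z => g (f z)) x = (mder E' E'' g y).comp (mder E E' f x) := by
  subst hy
  exact mfderiv_comp x hg hf

theorem mder_id (x : M) : mder E E (fun z : M => z) x = ContinuousLinearMap.id ℝ E :=
  mfderiv_id

theorem mder_const (c : M') (x : M) : mder E E' (fun _ : M => c) x = 0 :=
  mfderiv_const

end Derivatives

section Groups

variable {E : Type*} [NormedAddCommGroup E] [NormedSpace ℝ E]
  {M : Type*} [TopologicalSpace M] [ChartedSpace E M]
  {EG : Type*} [NormedAddCommGroup EG] [NormedSpace ℝ EG]
  {G : Type*} [TopologicalSpace G] [ChartedSpace EG G] [Group G] [LieGroup 𝓘(ℝ, EG) ∞ G]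

theorem mder_mul {p q : M → G} {x : M} (hp : MDifferentiableAt 𝓘(ℝ, E) 𝓘(ℝ, EG) p x)
    (hq : MDifferentiableAt 𝓘(ℝ, E) 𝓘(ℝ, EG) q x) (hp1 : p x = 1) (hq1 : q x = 1) :
    mder E EG (fun z => p z * q z) x = mder E EG p x + mder E EG q x := by
  have hmul : MDifferentiableAt (𝓘(ℝ, EG).prod 𝓘(ℝ, EG)) 𝓘(ℝ, EG)
      (fun z : G × G => z.1 * z.2) (p x, q x) :=
    ((contMDiff_mul 𝓘(ℝ, EG) ∞ (G := G)).mdifferentiable (by simp)) _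
  have h1 := mfderiv_comp x (g := fun z : G × G => z.1 * z.2) hmul (hp.prodMk hq)
  rw [mfderiv_prod_eq_add_comp hmul, hp.mfderiv_prod hq] at h1
  have h2 : mder EG EG (fun z : G => z * q x) (p x) = ContinuousLinearMap.id ℝ EG := by
    rw [hq1]; simp only [mul_one]; exact mder_id _
  have h3 : mder EG EG (fun z : G => p x * z) (q x) = ContinuousLinearMap.id ℝ EG := by
    rw [hp1]; simp only [one_mul]; exact mder_id _
  ext v
  have h4 := DFunLike.congr_fun h1 v
  refine Eq.trans h4 ?_
  change mder EG EG (fun z : G => z * q x) (p x) (mder E EG p x v) +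
    mder EG EG (fun z : G => p x * z) (q x) (mder E EG q x v) = _
  rw [h2, h3]
  rfl

theorem mdifferentiable_conj (g : G) :
    MDifferentiable 𝓘(ℝ, EG) 𝓘(ℝ, EG) (fun h : G => g * h * g⁻¹) :=
  ((contMDiff_const.mul contMDiff_id).mul contMDiff_const :
    ContMDiff 𝓘(ℝ, EG) 𝓘(ℝ, EG) ∞ (fun h : G => g * h * g⁻¹)).mdifferentiable (by simp)

theorem mdifferentiable_mul_const (g : G) :
    MDifferentiable 𝓘(ℝ, EG) 𝓘(ℝ, EG) (fun h : G => h * g) :=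
  (contMDiff_id.mul contMDiff_const :
    ContMDiff 𝓘(ℝ, EG) 𝓘(ℝ, EG) ∞ (fun h : G => h * g)).mdifferentiable (by simp)

theorem mdifferentiable_inv :
    MDifferentiable 𝓘(ℝ, EG) 𝓘(ℝ, EG) (fun h : G => h⁻¹) :=
  (contMDiff_inv 𝓘(ℝ, EG) ∞ (G := G)).mdifferentiable (by simp)

theorem adjointAction_mul (g h : G) (ξ : GroupLieAlgebra 𝓘(ℝ, EG) G) :
    adjointAction (EG := EG) (g * h) ξ = adjointAction g (adjointAction h ξ) := by
  have h1 := mder_comp (E := EG) (E' := EG) (E'' := EG) (f := fun k : G => h * k * h⁻¹) (x := 1)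
    (y := 1) (g := fun k : G => g * k * g⁻¹) (by simp) (mdifferentiable_conj g 1)
    (mdifferentiable_conj h 1)
  have h2 : (fun z : G => g * (h * z * h⁻¹) * g⁻¹) = fun z => (g * h) * z * (g * h)⁻¹ := by
    funext z; group
  rw [h2] at h1
  exact DFunLike.congr_fun h1 ξ

omit [LieGroup 𝓘(ℝ, EG) ∞ G] in
theorem adjointAction_one (ξ : GroupLieAlgebra 𝓘(ℝ, EG) G) :
    adjointAction (EG := EG) (1 : G) ξ = ξ := by
  have h2 : (fun z : G => 1 * z * 1⁻¹) = fun z => z := by funext z; group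
  have h1 : mder EG EG (fun z : G => 1 * z * 1⁻¹) 1 = ContinuousLinearMap.id ℝ EG := by
    rw [h2]; exact mder_id _
  exact DFunLike.congr_fun h1 ξ

theorem adjointAction_inv_apply (g : G) (ξ : GroupLieAlgebra 𝓘(ℝ, EG) G) :
    adjointAction (EG := EG) g (adjointAction g⁻¹ ξ) = ξ := by
  rw [← adjointAction_mul, mul_inv_cancel, adjointAction_one]

theorem thetaL_eq (g : G) (v : TangentSpace 𝓘(ℝ, EG) g) :
    thetaL g v = adjointAction (EG := EG) g⁻¹ (thetaR g v) := by
  have h1 := mder_comp (E := EG) (E' := EG) (E'' := EG) (f := fun k : G => k * g⁻¹) (x := g)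
    (y := 1) (g := fun k : G => g⁻¹ * k * g⁻¹⁻¹) (by simp) (mdifferentiable_conj g⁻¹ 1)
    (mdifferentiable_mul_const g⁻¹ g)
  have h2 : (fun z : G => g⁻¹ * (z * g⁻¹) * g⁻¹⁻¹) = fun z => g⁻¹ * z := by
    funext z; group
  rw [h2] at h1
  exact DFunLike.congr_fun h1 v

theorem mder_inv_one : mder EG EG (fun h : G => h⁻¹) 1 = -ContinuousLinearMap.id ℝ EG := by
  have h1 := mder_mul (E := EG) (p := fun h : G => h) (q := fun h : G => h⁻¹) (x := 1)
    mdifferentiableAt_id (mdifferentiable_inv 1) rfl inv_one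
  simp only [mul_inv_cancel, mder_const, mder_id] at h1
  exact (neg_eq_of_add_eq_zero_right h1.symm).symm

/-- Differentiating the equivariance of `Φ`: the right-trivialized derivative of `Φ` takes the
generating field of `ξ` to `Ad_Φ ξ - ξ`. -/
theorem thetaR_mfderiv_generatingField [IsManifold 𝓘(ℝ, E) ∞ M]
    [MulAction G M] [ContMDiffSMul 𝓘(ℝ, EG) 𝓘(ℝ, E) ∞ G M] {Φ : M → G}
    (hΦ : ContMDiff 𝓘(ℝ, E) 𝓘(ℝ, EG) ∞ Φ)
    (hequiv : ∀ (g : G) (m : M), Φ (g • m) = g * Φ m * g⁻¹) (m : M)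
    (ξ : GroupLieAlgebra 𝓘(ℝ, EG) G) :
    thetaR (Φ m) (mfderiv 𝓘(ℝ, E) 𝓘(ℝ, EG) Φ m (generatingField (EM := E) ξ m)) =
      adjointAction (EG := EG) (Φ m) ξ - ξ := by
  have horb : MDifferentiable 𝓘(ℝ, EG) 𝓘(ℝ, E) (fun g : G => g • m) := by
    have : ContMDiff 𝓘(ℝ, EG) 𝓘(ℝ, E) ∞ (fun g : G => g • m) :=
      (contMDiff_smul (I := 𝓘(ℝ, EG)) (I' := 𝓘(ℝ, E)) (n := ∞) (G := G) (M := M)).comp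
        (contMDiff_id.prodMk contMDiff_const)
    exact this.mdifferentiable (by simp)
  have hΦd := hΦ.mdifferentiable (by simp)
  have h1 := mder_comp (E := EG) (E' := E) (E'' := EG) (f := fun g : G => g • m) (x := 1) (y := m)
    (g := Φ) (one_smul G m) (hΦd m) (horb 1)
  have h2 := mder_comp (E := EG) (E' := EG) (E'' := EG) (f := fun g : G => Φ (g • m)) (x := 1)
    (y := Φ m) (g := fun k : G => k * (Φ m)⁻¹) (by rw [one_smul])
    (mdifferentiable_mul_const _ _) ((hΦd _).comp _ (horb 1))
  have h3 : (fun g : G => Φ (g • m) * (Φ m)⁻¹) = fun g => g * (Φ m * g⁻¹ * (Φ m)⁻¹) := by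
    funext g; rw [hequiv]; group
  have hconj : MDifferentiable 𝓘(ℝ, EG) 𝓘(ℝ, EG) (fun g : G => Φ m * g⁻¹ * (Φ m)⁻¹) :=
    (mdifferentiable_conj (Φ m)).comp mdifferentiable_inv
  have h4 := mder_mul (E := EG) (p := fun g : G => g) (q := fun g : G => Φ m * g⁻¹ * (Φ m)⁻¹)
    (x := 1) mdifferentiableAt_id (hconj 1) rfl (by simp)
  have h5 := mder_comp (E := EG) (E' := EG) (E'' := EG) (f := fun g : G => g⁻¹) (x := 1) (y := 1)
    (g := fun k : G => Φ m * k * (Φ m)⁻¹) inv_one (mdifferentiable_conj _ _)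
    (mdifferentiable_inv 1)
  rw [h3, h4, h5, h1, mder_inv_one, mder_id] at h2
  have h6 : ∀ ζ : EG, ((mder EG EG (fun k : G => k * (Φ m)⁻¹) (Φ m)).comp
      ((mder E EG Φ m).comp (mder EG E (fun g : G => g • m) 1))) (-ζ) =
      mder EG EG (fun k : G => Φ m * k * (Φ m)⁻¹) 1 ζ - ζ := by
    intro ζ
    rw [← h2]
    simp
    abel
  exact h6 ξ

end Groups

end ExteriorForm

/-! ### The top degree part at a point -/

namespace ExteriorForm

section Pin

variable {EG : Type*} [NormedAddCommGroup EG] [NormedSpace ℝ EG]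
  {G : Type*} [TopologicalSpace G] [ChartedSpace EG G] [Group G]
  {B : InvariantInnerProduct EG G}

/-- Reversion inverts the elements of `Pin`, and these elements are even or odd. -/
theorem pin_reverse_mul_and_involute {x : B.Clˣ} (hx : x ∈ B.Pin) :
    (CliffordAlgebra.reverse (x : B.Cl) * x = 1 ∧
        (x : B.Cl) * CliffordAlgebra.reverse (x : B.Cl) = 1) ∧
      (CliffordAlgebra.involute (x : B.Cl) = x ∨ CliffordAlgebra.involute (x : B.Cl) = -x) := by
  induction hx using Subgroup.closure_induction with
  | mem x hx =>
    obtain ⟨ξ, hξ, hx⟩ := hx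
    have h := ι_mul_self_of_form_eq_two (B := B.form) hξ
    rw [hx, CliffordAlgebra.reverse_ι, CliffordAlgebra.involute_ι]
    exact ⟨⟨h, h⟩, Or.inr rfl⟩
  | one => simp
  | mul x y _ _ hx hy =>
    obtain ⟨⟨hx1, hx2⟩, hx3⟩ := hx
    obtain ⟨⟨hy1, hy2⟩, hy3⟩ := hy
    refine ⟨⟨?_, ?_⟩, ?_⟩
    · rw [Units.val_mul, CliffordAlgebra.reverse.map_mul, mul_assoc,
        ← mul_assoc _ (x : B.Cl) (y : B.Cl), hx1, one_mul, hy1]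
    · rw [Units.val_mul, CliffordAlgebra.reverse.map_mul, mul_assoc,
        ← mul_assoc (y : B.Cl) _ _, hy2, one_mul, hx2]
    · rw [Units.val_mul, map_mul]
      rcases hx3 with h | h <;> rcases hy3 with h' | h' <;> rw [h, h'] <;> simp
  | inv x _ hx =>
    obtain ⟨⟨hx1, hx2⟩, hx3⟩ := hx
    have hinv : ((x⁻¹ : B.Clˣ) : B.Cl) = CliffordAlgebra.reverse (x : B.Cl) := by
      rw [Units.inv_eq_of_mul_eq_one_right hx2]
    rw [hinv, CliffordAlgebra.reverse_reverse, ← CliffordAlgebra.reverse_involute]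
    refine ⟨⟨hx2, hx1⟩, ?_⟩
    rcases hx3 with h | h <;> rw [h] <;> simp

variable (τ : B.PinLift)

/-- The Clifford algebra element `τ(g)`. -/
def liftElem (g : G) : CliffordAlgebra (halfQuad B.form) := ((τ.toHom g : B.Clˣ) : B.Cl)

theorem liftElem_isLift (g : G) :
    IsLift B.form (adjointAction (EG := EG) g).toLinearMap (liftElem τ g) := by
  intro ξ
  have h := τ.lifts g ξ
  have h2 := congrArg (fun x => x * ((τ.toHom g : B.Clˣ) : B.Cl)) h
  simp only [mul_assoc, Units.inv_mul, mul_one] at h2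
  exact h2

theorem liftElem_mul (g h : G) : liftElem τ (g * h) = liftElem τ g * liftElem τ h := by
  simp only [liftElem, map_mul]
  rfl

theorem liftElem_one : liftElem τ 1 = 1 := by
  simp only [liftElem, map_one]
  rfl

theorem liftElem_ne_zero (g : G) : liftElem τ g ≠ 0 := by
  intro h
  have h1 := (pin_reverse_mul_and_involute (τ.toHom g).2).1.1
  change CliffordAlgebra.reverse (liftElem τ g) * liftElem τ g = 1 at h1
  rw [h, mul_zero] at h1
  have h2 := congrArg (scalPart B.form) h1
  rw [map_zero, scalPart_one] at h2
  exact zero_ne_one h2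

theorem scalPart_liftElem_sq [FiniteDimensional ℝ EG] {g : G}
    (hA : ∀ ξ : GroupLieAlgebra 𝓘(ℝ, EG) G, adjointAction (EG := EG) g ξ + ξ = 0 → ξ = 0) :
    scalPart B.form (liftElem τ g) ^ 2 =
      LinearMap.det ((1 / 2 : ℝ) • (1 + (adjointAction (EG := EG) g).toLinearMap)) := by
  have : FiniteDimensional ℝ (GroupLieAlgebra 𝓘(ℝ, EG) G) :=
    inferInstanceAs (FiniteDimensional ℝ EG)
  exact (liftElem_isLift τ g).scalPart_sq B.symm B.pos (B.invariant g) hA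
    (pin_reverse_mul_and_involute (τ.toHom g).2).1.1

theorem scalPart_liftElem_ne_zero [FiniteDimensional ℝ EG] {g : G}
    (hA : ∀ ξ : GroupLieAlgebra 𝓘(ℝ, EG) G, adjointAction (EG := EG) g ξ + ξ = 0 → ξ = 0) :
    scalPart B.form (liftElem τ g) ≠ 0 := by
  have : FiniteDimensional ℝ (GroupLieAlgebra 𝓘(ℝ, EG) G) :=
    inferInstanceAs (FiniteDimensional ℝ EG)
  intro h
  exact liftElem_ne_zero τ g ((liftElem_isLift τ g).eq_zero B.symm B.pos hA h)

/-- Where `Ad_g` has no eigenvalue `-1`, the lift `τ(g)` is even, since its scalar part does not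
vanish. -/
theorem involute_liftElem [FiniteDimensional ℝ EG] {g : G}
    (hA : ∀ ξ : GroupLieAlgebra 𝓘(ℝ, EG) G, adjointAction (EG := EG) g ξ + ξ = 0 → ξ = 0) :
    CliffordAlgebra.involute (liftElem τ g) = liftElem τ g := by
  refine (pin_reverse_mul_and_involute (τ.toHom g).2).2.resolve_right fun h => ?_
  change CliffordAlgebra.involute (liftElem τ g) = -liftElem τ g at h
  have h1 := scalPart_involute B.symm (liftElem τ g)
  rw [h, map_neg] at h1
  exact scalPart_liftElem_ne_zero τ hA (by linarith)

end Pin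

section Pointwise

variable {EG : Type*} [NormedAddCommGroup EG] [NormedSpace ℝ EG]
  {G : Type*} [TopologicalSpace G] [ChartedSpace EG G] [Group G]
  {EM : Type*} [NormedAddCommGroup EM] [NormedSpace ℝ EM]
  {M : Type*} [TopologicalSpace M] [ChartedSpace EM M] [MulAction G M]
  {B : InvariantInnerProduct EG G} (X : GroupValuedHamiltonian EM M B) (τ : B.PinLift)

/-- The right-trivialized derivative of the moment map. -/
def momentDeriv (m : M) : TangentSpace 𝓘(ℝ, EM) m →ₗ[ℝ] GroupLieAlgebra 𝓘(ℝ, EG) G :=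
  (thetaR (EG := EG) (X.Φ m)).toLinearMap ∘ₗ (mfderiv 𝓘(ℝ, EM) 𝓘(ℝ, EG) X.Φ m).toLinearMap

theorem momentDeriv_apply (m : M) (v : TangentSpace 𝓘(ℝ, EM) m) :
    momentDeriv X m v = thetaR (X.Φ m) (mfderiv 𝓘(ℝ, EM) 𝓘(ℝ, EG) X.Φ m v) := rfl

variable (EG EM G) in
/-- The infinitesimal action at a point. -/
def infAction (m : M) : GroupLieAlgebra 𝓘(ℝ, EG) G →ₗ[ℝ] TangentSpace 𝓘(ℝ, EM) m where
  toFun ξ := generatingField (EM := EM) ξ m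
  map_add' ξ ζ := by
    have h : ∀ ξ ζ : EG, mder EG EM (fun g : G => g • m) 1 (-(ξ + ζ)) =
      mder EG EM (fun g : G => g • m) 1 (-ξ) + mder EG EM (fun g : G => g • m) 1 (-ζ) := by
      intro ξ ζ; rw [neg_add, map_add]
    exact h ξ ζ
  map_smul' r ξ := by
    have h : ∀ (r : ℝ) (ξ : EG), mder EG EM (fun g : G => g • m) 1 (-(r • ξ)) =
      r • mder EG EM (fun g : G => g • m) 1 (-ξ) := by
      intro r ξ; rw [← smul_neg, map_smul]
    exact h r ξ

/-- The equivariance of the moment map and the conditions on the 2-form, at a point. -/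
theorem hamiltonianPoint [LieGroup 𝓘(ℝ, EG) ∞ G] [IsManifold 𝓘(ℝ, EM) ∞ M]
    [ContMDiffSMul 𝓘(ℝ, EG) 𝓘(ℝ, EM) ∞ G M] (m : M) :
    HamiltonianPoint B.form (adjointAction (EG := EG) (X.Φ m)).toLinearMap (X.twoForm m)
      (momentDeriv X m) (infAction EG G EM m) where
  symm := B.symm
  pos := B.pos
  isometry := B.invariant _
  moment ξ v := by
    refine (X.moment ξ m v).trans ?_
    rw [thetaL_eq, ← momentDeriv_apply]
    congr 1
    have h := B.invariant (X.Φ m) (adjointAction (X.Φ m)⁻¹ (momentDeriv X m v)) ξ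
    rw [adjointAction_inv_apply] at h
    rw [map_add, LinearMap.add_apply, ← h, map_add]
    rfl
  map_action ξ := thetaR_mfderiv_generatingField X.smooth_Φ X.equivariant m ξ
  ker v hv := (X.ker_twoForm m v).1 hv
  ker' ξ hξ := (X.ker_twoForm m _).2 ⟨ξ, hξ, rfl⟩

variable [FiniteDimensional ℝ EM]

theorem Gam_eq (m : M) :
    X.Gam τ m = expTwoForm (X.twoForm m) * ExteriorAlgebra.map
      (HamiltonianPoint.halfDual B.form (momentDeriv X m)) (symb B.form (liftElem τ (X.Φ m))) := by
  have h : X.pullback m (InvariantInnerProduct.formT τ (X.Φ m)) = ExteriorAlgebra.map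
      (HamiltonianPoint.halfDual B.form (momentDeriv X m))
      (symb B.form (liftElem τ (X.Φ m))) := by
    simp only [GroupValuedHamiltonian.pullback, InvariantInnerProduct.formT,
      InvariantInnerProduct.scaleHalf, ← AlgHom.comp_apply, ExteriorAlgebra.map_comp_map]
    congr 2
    ext ξ v
    simp [InvariantInnerProduct.thetaRDual, HamiltonianPoint.halfDual, momentDeriv]
  rw [GroupValuedHamiltonian.Gam, h]
  rfl

variable [FiniteDimensional ℝ EG] [LieGroup 𝓘(ℝ, EG) ∞ G] [IsManifold 𝓘(ℝ, EM) ∞ M]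
    [ContMDiffSMul 𝓘(ℝ, EG) 𝓘(ℝ, EM) ∞ G M]

theorem GamTop_ne_zero (m : M) : X.GamTop τ m ≠ 0 := by
  have : FiniteDimensional ℝ (GroupLieAlgebra 𝓘(ℝ, EG) G) :=
    inferInstanceAs (FiniteDimensional ℝ EG)
  intro h
  refine (hamiltonianPoint X m).formPartAlg_ne_zero (liftElem_isLift τ (X.Φ m))
    (liftElem_ne_zero τ _) ?_
  rw [← Gam_eq]
  ext v
  exact DFunLike.congr_fun h v

theorem scalPart_smul_GamTop (m : M)
    (hnd : ∀ v : TangentSpace 𝓘(ℝ, EM) m, (∀ w, X.twoForm m ![v, w] = 0) → v = 0) :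
    scalPart B.form (liftElem τ (X.Φ m)) • X.GamTop τ m = X.expOmegaTop m := by
  have : FiniteDimensional ℝ (GroupLieAlgebra 𝓘(ℝ, EG) G) :=
    inferInstanceAs (FiniteDimensional ℝ EG)
  have hA := (hamiltonianPoint X m).eq_zero_of_nondegenerate hnd
  have hpin := pin_reverse_mul_and_involute (τ.toHom (X.Φ m)).2
  have h := (hamiltonianPoint X m).scalPart_smul_formPartAlg hA (liftElem_isLift τ (X.Φ m))
    (involute_liftElem τ hA) hpin.1.1 hpin.1.2
  rw [← Gam_eq] at h
  ext v
  exact DFunLike.congr_fun h v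

/-- The sign in the comparison of the two top degree forms is the sign of the scalar part of the
lift. -/
theorem exists_sign_GamTop : ∃ ε : G → ℤˣ, ∀ m : M,
    (∀ v : TangentSpace 𝓘(ℝ, EM) m, (∀ w, X.twoForm m ![v, w] = 0) → v = 0) →
      X.GamTop τ m =
        ((ε (X.Φ m) : ℤ) : ℝ) •
          (Real.sqrt |LinearMap.det ((1 / 2 : ℝ) •
            (1 + (adjointAction (EG := EG) (X.Φ m)).toLinearMap))|)⁻¹ • X.expOmegaTop m := by
  classical
  refine ⟨fun g => if 0 ≤ scalPart B.form (liftElem τ g) then 1 else -1, fun m hnd => ?_⟩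
  have hA : ∀ ξ : GroupLieAlgebra 𝓘(ℝ, EG) G, adjointAction (EG := EG) (X.Φ m) ξ + ξ = 0 → ξ = 0 :=
    (hamiltonianPoint X m).eq_zero_of_nondegenerate hnd
  have hne := scalPart_liftElem_ne_zero τ hA
  rw [← scalPart_smul_GamTop X τ m hnd, ← scalPart_liftElem_sq τ hA, abs_of_nonneg (sq_nonneg _),
    Real.sqrt_sq_eq_abs, smul_smul, smul_smul]
  set c := scalPart B.form (liftElem τ (X.Φ m))
  have h1 : (((if 0 ≤ c then 1 else -1 : ℤˣ) : ℤ) : ℝ) * (|c|⁻¹ * c) = 1 := by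
    split_ifs with h
    · rw [abs_of_nonneg h]; simp [hne]
    · rw [abs_of_neg (not_le.1 h)]; field_simp; simp
  rw [mul_assoc, h1, one_smul]

end Pointwise

end ExteriorForm

/-! ### Smooth families in vector spaces without topology -/

namespace ExteriorForm

open ExteriorAlgebra Filter Topology

section FinSmooth

variable {E : Type*} [NormedAddCommGroup E] [NormedSpace ℝ E]
  {X : Type*} [AddCommGroup X] [Module ℝ X] {X' : Type*} [AddCommGroup X'] [Module ℝ X']

/-- A family of vectors is smooth at `y₀` if near `y₀` it is a finite sum of constant vectors with
smooth coefficients. This notion needs no topology on the space of values, and it is equivalent to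
the usual one in finite dimension. -/
inductive FinSmoothAt (y₀ : E) : (E → X) → Prop
  | smul (f : E → ℝ) (hf : ContDiffAt ℝ ∞ f y₀) (c : X) : FinSmoothAt y₀ (fun y => f y • c)
  | add (F F' : E → X) (hF : FinSmoothAt y₀ F) (hF' : FinSmoothAt y₀ F') :
      FinSmoothAt y₀ (fun y => F y + F' y)
  | congr (F F' : E → X) (hF : FinSmoothAt y₀ F) (h : F =ᶠ[𝓝 y₀] F') : FinSmoothAt y₀ F'

namespace FinSmoothAt

variable {y₀ : E}

theorem const (c : X) : FinSmoothAt y₀ (fun _ => c) := by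
  simpa using smul (y₀ := y₀) (fun _ => (1 : ℝ)) contDiffAt_const c

theorem sum {n : Type*} (s : Finset n) (F : n → E → X) (h : ∀ i ∈ s, FinSmoothAt y₀ (F i)) :
    FinSmoothAt y₀ (fun y => ∑ i ∈ s, F i y) := by
  classical
  induction s using Finset.induction_on with
  | empty => simpa using const (y₀ := y₀) (0 : X)
  | insert i s hi ih =>
    simp only [Finset.sum_insert hi]
    exact add _ _ (h i (Finset.mem_insert_self i s))
      (ih fun j hj => h j (Finset.mem_insert_of_mem hj))

theorem map {F : E → X} (hF : FinSmoothAt y₀ F) (l : X →ₗ[ℝ] X') :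
    FinSmoothAt y₀ (fun y => l (F y)) := by
  induction hF with
  | smul f hf c => simpa using smul f hf (l c)
  | add F F' _ _ ih ih' => simpa using add _ _ ih ih'
  | congr F F' _ h ih => exact congr _ _ ih (h.fun_comp l)

theorem fun_smul {F : E → X} (hF : FinSmoothAt y₀ F) {f : E → ℝ} (hf : ContDiffAt ℝ ∞ f y₀) :
    FinSmoothAt y₀ (fun y => f y • F y) := by
  induction hF with
  | smul f' hf' c => simpa only [smul_smul] using smul _ (hf.mul hf') c
  | add F F' _ _ ih ih' => simpa only [smul_add] using add _ _ ih ih'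
  | congr F F' _ h ih => exact congr _ _ ih (h.mono fun y hy => by simp only [hy])

theorem const_smul {F : E → X} (hF : FinSmoothAt y₀ F) (r : ℝ) :
    FinSmoothAt y₀ (fun y => r • F y) := hF.fun_smul contDiffAt_const

theorem contDiffAt {F : E → ℝ} (hF : FinSmoothAt y₀ F) : ContDiffAt ℝ ∞ F y₀ := by
  induction hF with
  | smul f hf c => exact hf.smul contDiffAt_const
  | add F F' _ _ ih ih' => exact ih.add ih'
  | congr F F' _ h ih => exact ih.congr_of_eventuallyEq h.symm

theorem mul {A : Type*} [Ring A] [Algebra ℝ A] {F F' : E → A} (hF : FinSmoothAt y₀ F)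
    (hF' : FinSmoothAt y₀ F') : FinSmoothAt y₀ (fun y => F y * F' y) := by
  induction hF with
  | smul f hf c =>
    simpa using (hF'.map (LinearMap.mulLeft ℝ c)).fun_smul hf
  | add F₁ F₂ _ _ ih ih' => simpa only [add_mul] using add _ _ ih ih'
  | congr F₁ F₂ _ h ih => exact congr _ _ ih (h.mono fun y hy => by simp only [hy])

theorem pow {A : Type*} [Ring A] [Algebra ℝ A] {F : E → A} (hF : FinSmoothAt y₀ F) (k : ℕ) :
    FinSmoothAt y₀ (fun y => F y ^ k) := by
  induction k with
  | zero => simpa using const (y₀ := y₀) (1 : A)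
  | succ k ih => simpa only [pow_succ] using ih.mul hF

theorem of_basis {n : Type*} [Fintype n] (b : Module.Basis n ℝ X) {F : E → X}
    (h : ∀ i, ContDiffAt ℝ ∞ (fun y => b.repr (F y) i) y₀) : FinSmoothAt y₀ F := by
  have h1 := sum (y₀ := y₀) Finset.univ (fun i y => b.repr (F y) i • b i)
    (fun i _ => smul _ (h i) (b i))
  simpa only [b.sum_repr] using h1

theorem of_contDiffAt {W : Type*} [NormedAddCommGroup W] [NormedSpace ℝ W] [FiniteDimensional ℝ W]
    {F : E → W} (h : ContDiffAt ℝ ∞ F y₀) : FinSmoothAt y₀ F :=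
  of_basis (Module.finBasis ℝ W) fun i =>
    (LinearMap.toContinuousLinearMap ((Module.finBasis ℝ W).coord i)).contDiff.contDiffAt.comp y₀ h

theorem exteriorAlgebra_map_const {j : E → X →ₗ[ℝ] X'} (hj : ∀ ξ, FinSmoothAt y₀ (fun y => j y ξ))
    (x : ExteriorAlgebra ℝ X) : FinSmoothAt y₀ (fun y => ExteriorAlgebra.map (j y) x) := by
  induction x using left_induction with
  | algebraMap r => simpa using const (y₀ := y₀) _
  | add x x' hx hx' => simpa using add _ _ hx hx'
  | ι_mul x a hx => simpa using ((hj a).map (ι ℝ)).mul hx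

theorem exteriorAlgebra_map {j : E → X →ₗ[ℝ] X'} (hj : ∀ ξ, FinSmoothAt y₀ (fun y => j y ξ))
    {F : E → ExteriorAlgebra ℝ X} (hF : FinSmoothAt y₀ F) :
    FinSmoothAt y₀ (fun y => ExteriorAlgebra.map (j y) (F y)) := by
  induction hF with
  | smul f hf c => simpa using (exteriorAlgebra_map_const hj c).fun_smul hf
  | add F F' _ _ ih ih' => simpa using add _ _ ih ih'
  | congr F F' _ h ih => exact congr _ _ ih (h.mono fun y hy => by simp only [hy])

/-- A family of multi-vectors solving the equations `bⁱ ⌟ Y = βᵢ ∧ Y` with smooth coefficients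
`βᵢ` is smooth as soon as its scalar part is. -/
theorem of_contr_eq {W : Type*} [AddCommGroup W] [Module ℝ W] [FiniteDimensional ℝ W]
    {n : Type*} [Fintype n] (b : Module.Basis n ℝ W) {Y : E → ExteriorAlgebra ℝ W}
    {β : n → E → W} (hβ : ∀ i, FinSmoothAt y₀ (β i))
    (hY : ∀ i, ∀ᶠ y in 𝓝 y₀, contr (b.coord i) (Y y) = ι ℝ (β i y) * Y y)
    (h0 : ContDiffAt ℝ ∞ (fun y => algebraMapInv (Y y)) y₀) : FinSmoothAt y₀ Y := by
  have hpart : ∀ k, FinSmoothAt y₀ (fun y => homPart k (Y y)) := by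
    intro k
    induction k using Nat.strong_induction_on with
    | _ k ih =>
      cases k with
      | zero =>
        simpa only [homPart_zero_eq, Algebra.algebraMap_eq_smul_one] using
          smul (y₀ := y₀) _ h0 (1 : ExteriorAlgebra ℝ W)
      | succ k =>
        -- Euler's identity expresses a homogeneous part by its interior products.
        have heq : ∀ y, homPart (k + 1) (Y y) = ((k + 1 : ℕ) : ℝ)⁻¹ •
            ∑ i, ι ℝ (b i) * homPart k (contr (b.coord i) (Y y)) := by
          intro y
          have h := sum_ι_mul_contr b (k + 1) (Y y)
          rw [eq_inv_smul_iff₀ (by positivity), ← h]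
          simp only [contr_homPart_succ]
        simp only [heq]
        refine (sum _ _ fun i _ => ?_).const_smul _
        refine (const _).mul ?_
        have hi := (hY i).mono fun y hy => congrArg (homPart k) hy.symm
        refine congr _ _ ?_ hi
        cases k with
        | zero => simpa only [homPart_zero_ι_mul] using const (y₀ := y₀) _
        | succ k =>
          simp only [homPart_succ_ι_mul]
          exact ((hβ i).map (ι ℝ)).mul (ih k (by omega))
  have h1 := sum (y₀ := y₀) (Finset.range (Module.finrank ℝ W + 1))
    (fun k y => homPart k (Y y)) (fun k _ => hpart k)
  simpa only [sum_homPart] using h1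

theorem expTwoForm_of_contDiffAt {V : Type*} [AddCommGroup V] [Module ℝ V]
    [TopologicalSpace V] [FiniteDimensional ℝ V] {β : E → V [⋀^Fin 2]→L[ℝ] ℝ}
    (hβ : ∀ v, ContDiffAt ℝ ∞ (fun y => β y v) y₀) :
    FinSmoothAt y₀ (fun y => expTwoForm (β y)) := by
  refine sum _ _ fun k _ => (pow ?_ k).const_smul _
  exact (sum _ _ fun i _ => sum _ _ fun j _ => smul _ (hβ _) _).const_smul _

end FinSmoothAt

end FinSmooth

theorem contDiffAt_det {E : Type*} [NormedAddCommGroup E] [NormedSpace ℝ E]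
    {W : Type*} [NormedAddCommGroup W] [NormedSpace ℝ W] [FiniteDimensional ℝ W] {y₀ : E}
    {A : E → W →L[ℝ] W} (hA : ContDiffAt ℝ ∞ A y₀) :
    ContDiffAt ℝ ∞ (fun y => LinearMap.det (A y).toLinearMap) y₀ := by
  let b := Module.finBasis ℝ W
  have h : ∀ y, LinearMap.det (A y).toLinearMap =
      ∑ σ : Equiv.Perm (Fin (Module.finrank ℝ W)), (Equiv.Perm.sign σ : ℝ) *
        ∏ i, b.coord (σ i) (A y (b i)) := by
    intro y
    rw [← LinearMap.det_toMatrix b, Matrix.det_apply']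
    simp [LinearMap.toMatrix_apply]
  simp only [h]
  refine ContDiffAt.sum fun σ _ => contDiffAt_const.mul (contDiffAt_prod fun i _ => ?_)
  exact (LinearMap.toContinuousLinearMap (b.coord (σ i))).contDiff.contDiffAt.comp y₀
    (hA.clm_apply contDiffAt_const)

end ExteriorForm

/-! ### Smoothness of the adjoint action and of the Clifford lift -/

namespace ExteriorForm

open Filter Topology

section Families

variable {E : Type*} [NormedAddCommGroup E] [NormedSpace ℝ E]
  {E₁ : Type*} [NormedAddCommGroup E₁] [NormedSpace ℝ E₁]
  {EG : Type*} [NormedAddCommGroup EG] [NormedSpace ℝ EG]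
  {G : Type*} [TopologicalSpace G] [ChartedSpace EG G]

theorem mder_eq_fderiv_extChartAt {f : E → G} {x : E} {g : G} (hx : f x = g)
    (hf : MDifferentiableAt 𝓘(ℝ, E) 𝓘(ℝ, EG) f x) :
    mder E EG f x = fderiv ℝ (fun z => extChartAt 𝓘(ℝ, EG) g (f z)) x := by
  subst hx
  refine hf.mfderiv.trans ?_
  simp only [modelWithCornersSelf_coe, Set.range_id, fderivWithin_univ]
  rfl

theorem mder_self_eq_fderiv_extChartAt {f : G → G} {g : G} (hx : f g = g)
    (hf : MDifferentiableAt 𝓘(ℝ, EG) 𝓘(ℝ, EG) f g) :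
    mder EG EG f g = fderiv ℝ
      (fun z => extChartAt 𝓘(ℝ, EG) g (f ((extChartAt 𝓘(ℝ, EG) g).symm z)))
        (extChartAt 𝓘(ℝ, EG) g g) := by
  refine hf.mfderiv.trans ?_
  simp only [modelWithCornersSelf_coe, Set.range_id, fderivWithin_univ, writtenInExtChartAt, hx]
  rfl

/-- Smooth dependence on parameters of the derivative of a family of maps to a manifold, read in a
fixed chart. -/
theorem contDiffAt_fderiv_extChartAt {K : E × E₁ → G} {p : E → E₁} {y₀ : E} {g : G}
    (hK : ContMDiffAt 𝓘(ℝ, E × E₁) 𝓘(ℝ, EG) ∞ K (y₀, p y₀)) (hg : K (y₀, p y₀) = g)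
    (hp : ContDiffAt ℝ ∞ p y₀) :
    ContDiffAt ℝ ∞ (fun y => fderiv ℝ (fun z => extChartAt 𝓘(ℝ, EG) g (K (y, z))) (p y)) y₀ := by
  subst hg
  refine ContDiffAt.fderiv (n := ∞) (f := fun y z => extChartAt 𝓘(ℝ, EG) (K (y₀, p y₀)) (K (y, z)))
    ?_ hp (by simp)
  rw [← contMDiffAt_iff_contDiffAt]
  exact (contMDiffAt_extChartAt (I := 𝓘(ℝ, EG)) (n := ∞) (x := K (y₀, p y₀))).comp _ hK

end Families

section Groups

variable {E : Type*} [NormedAddCommGroup E] [NormedSpace ℝ E]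
  {EG : Type*} [NormedAddCommGroup EG] [NormedSpace ℝ EG]
  {G : Type*} [TopologicalSpace G] [ChartedSpace EG G] [Group G] [LieGroup 𝓘(ℝ, EG) ∞ G]

/-- The adjoint action depends smoothly on the group element. -/
theorem contDiffAt_adjointAction {γ : E → G} {y₀ : E}
    (hγ : ContMDiffAt 𝓘(ℝ, E) 𝓘(ℝ, EG) ∞ γ y₀) :
    ContDiffAt ℝ ∞ (fun y => mder EG EG (fun h : G => γ y * h * (γ y)⁻¹) 1) y₀ := by
  have h1 : ∀ y, mder EG EG (fun h : G => γ y * h * (γ y)⁻¹) 1 = fderiv ℝ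
      (fun z => extChartAt 𝓘(ℝ, EG) (1 : G)
        (γ y * (extChartAt 𝓘(ℝ, EG) (1 : G)).symm z * (γ y)⁻¹))
        (extChartAt 𝓘(ℝ, EG) (1 : G) 1) := fun y =>
    mder_self_eq_fderiv_extChartAt (by simp) (mdifferentiable_conj (γ y) 1)
  simp only [h1]
  have hsymm : ContMDiffAt 𝓘(ℝ, EG) 𝓘(ℝ, EG) ∞ (extChartAt 𝓘(ℝ, EG) (1 : G)).symm
      (extChartAt 𝓘(ℝ, EG) (1 : G) 1) :=
    (contMDiffOn_extChartAt_symm (1 : G)).contMDiffAt (extChartAt_target_mem_nhds (1 : G))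
  have hfst : ContMDiffAt 𝓘(ℝ, E × EG) 𝓘(ℝ, EG) ∞ (fun q : E × EG => γ q.1)
      (y₀, extChartAt 𝓘(ℝ, EG) (1 : G) 1) :=
    ContMDiffAt.comp (I' := 𝓘(ℝ, E)) (g := γ) (f := fun q : E × EG => q.1) _ hγ
      contDiff_fst.contMDiff.contMDiffAt
  have hsnd : ContMDiffAt 𝓘(ℝ, E × EG) 𝓘(ℝ, EG) ∞
      (fun q : E × EG => (extChartAt 𝓘(ℝ, EG) (1 : G)).symm q.2)
      (y₀, extChartAt 𝓘(ℝ, EG) (1 : G) 1) :=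
    ContMDiffAt.comp (I' := 𝓘(ℝ, EG)) (g := (extChartAt 𝓘(ℝ, EG) (1 : G)).symm)
      (f := fun q : E × EG => q.2) _ hsymm contDiff_snd.contMDiff.contMDiffAt
  exact contDiffAt_fderiv_extChartAt
    (K := fun q : E × EG => γ q.1 * (extChartAt 𝓘(ℝ, EG) (1 : G)).symm q.2 * (γ q.1)⁻¹)
    (p := fun _ => extChartAt 𝓘(ℝ, EG) (1 : G) 1) ((hfst.mul hsnd).mul hfst.inv) (by simp)
    contDiffAt_const

/-- The right-trivialized derivative of a smooth map to a Lie group is smooth. -/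
theorem contDiffAt_mder_mul_inv {γ : E → G} {s : Set E} (hs : IsOpen s)
    (hγ : ContMDiffOn 𝓘(ℝ, E) 𝓘(ℝ, EG) ∞ γ s) {y₀ : E} (hy₀ : y₀ ∈ s) :
    ContDiffAt ℝ ∞ (fun y => mder E EG (fun z => γ z * (γ y)⁻¹) y) y₀ := by
  have hγ₀ := hγ.contMDiffAt (hs.mem_nhds hy₀)
  have h1 : (fun y => fderiv ℝ (fun z => extChartAt 𝓘(ℝ, EG) (1 : G) (γ z * (γ y)⁻¹)) y) =ᶠ[𝓝 y₀]
      fun y => mder E EG (fun z => γ z * (γ y)⁻¹) y := by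
    filter_upwards [hs.mem_nhds hy₀] with y hy
    refine (mder_eq_fderiv_extChartAt (f := fun z => γ z * (γ y)⁻¹) (mul_inv_cancel (γ y)) ?_).symm
    exact ((hγ.contMDiffAt (hs.mem_nhds hy)).mul contMDiffAt_const).mdifferentiableAt (by simp)
  refine ContDiffAt.congr_of_eventuallyEq ?_ h1.symm
  have hfst : ContMDiffAt 𝓘(ℝ, E × E) 𝓘(ℝ, EG) ∞ (fun q : E × E => γ q.1) (y₀, y₀) :=
    ContMDiffAt.comp (I' := 𝓘(ℝ, E)) (g := γ) (f := fun q : E × E => q.1) _ hγ₀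
      contDiff_fst.contMDiff.contMDiffAt
  have hsnd : ContMDiffAt 𝓘(ℝ, E × E) 𝓘(ℝ, EG) ∞ (fun q : E × E => γ q.2) (y₀, y₀) :=
    ContMDiffAt.comp (I' := 𝓘(ℝ, E)) (g := γ) (f := fun q : E × E => q.2) _ hγ₀
      contDiff_snd.contMDiff.contMDiffAt
  exact contDiffAt_fderiv_extChartAt (K := fun q : E × E => γ q.2 * (γ q.1)⁻¹) (p := fun y => y)
    (hsnd.mul hfst.inv) (by simp) contDiffAt_id

variable [FiniteDimensional ℝ EG] {B : InvariantInnerProduct EG G} (τ : B.PinLift)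

/-- The symbol of the lift is smooth near the identity: its scalar part is the continuous square
root of `det ((1 + Ad) / 2)`, and `Ad` determines the higher degrees. -/
theorem finSmoothAt_symb_liftElem_of_eq_one {γ : E → G} {y₀ : E}
    (hγ : ContMDiffAt 𝓘(ℝ, E) 𝓘(ℝ, EG) ∞ γ y₀) (h1 : γ y₀ = 1) :
    FinSmoothAt y₀ (fun y => symb B.form (liftElem τ (γ y))) := by
  have hfdW : FiniteDimensional ℝ (GroupLieAlgebra 𝓘(ℝ, EG) G) :=
    inferInstanceAs (FiniteDimensional ℝ EG)
  have hcomplete : CompleteSpace EG := FiniteDimensional.complete ℝ EG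
  let A : E → EG →L[ℝ] EG := fun y => mder EG EG (fun h : G => γ y * h * (γ y)⁻¹) 1
  have hA : ContDiffAt ℝ ∞ A y₀ := contDiffAt_adjointAction hγ
  have hAy₀ : A y₀ = 1 := by
    ext ξ
    have := adjointAction_one (G := G) (EG := EG) ξ
    rw [← h1] at this
    exact this
  have hunit₀ : IsUnit (A y₀ + 1) := by
    rw [hAy₀, one_add_one_eq_two]
    have := (isUnit_iff_ne_zero.2 (two_ne_zero' ℝ)).map (algebraMap ℝ (EG →L[ℝ] EG))
    rwa [map_ofNat] at this
  have hunit : ∀ᶠ y in 𝓝 y₀, IsUnit (A y + 1) :=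
    (hA.continuousAt.add continuousAt_const).eventually (Units.isOpen.mem_nhds hunit₀)
  have hinv : ContDiffAt ℝ ∞ (fun y => Ring.inverse (A y + 1)) y₀ := by
    have h2 : ContDiffAt ℝ ∞ Ring.inverse (A y₀ + 1) := by
      have := contDiffAt_ringInverse ℝ (n := ∞) hunit₀.unit
      rwa [IsUnit.unit_spec] at this
    exact h2.comp y₀ (hA.add contDiffAt_const)
  have hker : ∀ y, IsUnit (A y + 1) → ∀ ξ : GroupLieAlgebra 𝓘(ℝ, EG) G,
      adjointAction (EG := EG) (γ y) ξ + ξ = 0 → ξ = 0 := by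
    intro y hy ξ hξ
    have h2 : Ring.inverse (A y + 1) * (A y + 1) = 1 := Ring.inverse_mul_cancel _ hy
    have h3 : ∀ ξ : EG, A y ξ + ξ = 0 → ξ = 0 := by
      intro ξ hξ
      have h3 : Ring.inverse (A y + 1) (A y ξ + ξ) = ξ := DFunLike.congr_fun h2 ξ
      rw [← h3, hξ, map_zero]
    exact h3 ξ hξ
  let b : Module.Basis _ ℝ (GroupLieAlgebra 𝓘(ℝ, EG) G) :=
    Module.finBasis ℝ (GroupLieAlgebra 𝓘(ℝ, EG) G)
  choose u hu using fun i => exists_form_eq B.pos (b.coord i)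
  let β : _ → E → EG := fun i y =>
    (-2 : ℝ) • ((A y - 1) (Ring.inverse (A y + 1) (u i : EG)))
  have hβ : ∀ i, FinSmoothAt y₀ (β i) := fun i =>
    (FinSmoothAt.of_contDiffAt ((hA.sub contDiffAt_const).clm_apply
      (hinv.clm_apply contDiffAt_const))).const_smul _
  refine FinSmoothAt.of_contr_eq b (β := β) hβ (fun i => ?_) ?_
  · filter_upwards [hunit] with y hy
    have h2 : (A y + 1) * Ring.inverse (A y + 1) = 1 := Ring.mul_inverse_cancel _ hy
    let ξ : GroupLieAlgebra 𝓘(ℝ, EG) G := (Ring.inverse (A y + 1) (u i : EG) : EG)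
    have hξ : adjointAction (EG := EG) (γ y) ξ + ξ = u i := DFunLike.congr_fun h2 (u i : EG)
    have h3 := (liftElem_isLift τ (γ y)).ι_mul_symb B.symm ξ
    rw [ContinuousLinearMap.coe_coe, hξ, hu] at h3
    have h4 : β i y = (-2 : ℝ) • (adjointAction (EG := EG) (γ y) ξ - ξ) := rfl
    rw [h4, map_smul, smul_mul_assoc, h3, smul_smul]
    norm_num
  · have hcont : ContinuousAt (fun y => scalPart B.form (liftElem τ (γ y))) y₀ :=
      (τ.continuous (scalPart B.form)).continuousAt.comp hγ.continuousAt
    have hone : scalPart B.form (liftElem τ (γ y₀)) = 1 := by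
      rw [h1, liftElem_one, scalPart_one]
    have hpos : ∀ᶠ y in 𝓝 y₀, 0 < scalPart B.form (liftElem τ (γ y)) :=
      hcont.eventually (lt_mem_nhds (by
        show 0 < scalPart B.form (liftElem τ (γ y₀))
        rw [hone]; exact one_pos))
    let D : E → ℝ := fun y => LinearMap.det ((1 / 2 : ℝ) • (1 + A y) : EG →L[ℝ] EG).toLinearMap
    have hA' : ContDiffAt ℝ ∞ (fun y => (1 / 2 : ℝ) • (1 + A y)) y₀ :=
      (contDiffAt_const.add hA).const_smul _
    have hD : ContDiffAt ℝ ∞ D y₀ := contDiffAt_det hA'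
    have hsq : ∀ y, IsUnit (A y + 1) → scalPart B.form (liftElem τ (γ y)) ^ 2 = D y := by
      intro y hy
      exact scalPart_liftElem_sq τ (hker y hy)
    have hDne : D y₀ ≠ 0 := by
      rw [← hsq y₀ hunit₀, hone]; norm_num
    refine (hD.sqrt hDne).congr_of_eventuallyEq ?_
    filter_upwards [hunit, hpos] with y hy hy'
    rw [← hsq y hy, Real.sqrt_sq hy'.le]
    rfl

/-- The symbol of the lift is smooth: translating by `τ (γ y₀)` reduces to the identity. -/
theorem finSmoothAt_symb_liftElem {γ : E → G} {y₀ : E}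
    (hγ : ContMDiffAt 𝓘(ℝ, E) 𝓘(ℝ, EG) ∞ γ y₀) :
    FinSmoothAt y₀ (fun y => symb B.form (liftElem τ (γ y))) := by
  have h := finSmoothAt_symb_liftElem_of_eq_one τ (γ := fun y => (γ y₀)⁻¹ * γ y)
    (contMDiffAt_const.mul hγ) (by simp)
  have h2 := h.map ((symb B.form).toLinearMap ∘ₗ LinearMap.mulLeft ℝ (liftElem τ (γ y₀)) ∘ₗ
    (symb B.form).symm.toLinearMap)
  simpa only [LinearMap.comp_apply, LinearEquiv.coe_coe, LinearEquiv.symm_apply_apply,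
    LinearMap.mulLeft_apply, ← liftElem_mul, mul_inv_cancel_left] using h2

end Groups

end ExteriorForm

/-! ### Smoothness of the top degree part -/

namespace ExteriorForm

open Filter Topology

section ExpTwoForm

variable {V V' : Type*} [AddCommGroup V] [Module ℝ V] [TopologicalSpace V] [FiniteDimensional ℝ V]
  [AddCommGroup V'] [Module ℝ V'] [TopologicalSpace V'] [FiniteDimensional ℝ V']

theorem map_dualMap_expTwoForm (f : V' →L[ℝ] V) (β : V [⋀^Fin 2]→L[ℝ] ℝ)
    (h : Module.finrank ℝ V' = Module.finrank ℝ V) :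
    ExteriorAlgebra.map f.toLinearMap.dualMap (expTwoForm β) =
      expTwoForm (β.compContinuousLinearMap f) := by
  simp only [expTwoForm, map_sum, map_smul, map_pow, map_dualMap_twoFormElem, h]

end ExpTwoForm

variable {EG : Type*} [NormedAddCommGroup EG] [NormedSpace ℝ EG]
  {G : Type*} [TopologicalSpace G] [ChartedSpace EG G] [Group G]
  {EM : Type*} [NormedAddCommGroup EM] [NormedSpace ℝ EM]
  {M : Type*} [TopologicalSpace M] [ChartedSpace EM M] [IsManifold 𝓘(ℝ, EM) ∞ M] [MulAction G M]
  {B : InvariantInnerProduct EG G} (X : GroupValuedHamiltonian EM M B) (τ : B.PinLift)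

/-- The moment map in the preferred chart at `x`. -/
def momentInChart (x : M) : EM → G := fun y => X.Φ ((extChartAt 𝓘(ℝ, EM) x).symm y)

theorem contMDiffOn_momentInChart (x : M) :
    ContMDiffOn 𝓘(ℝ, EM) 𝓘(ℝ, EG) ∞ (momentInChart X x) (extChartAt 𝓘(ℝ, EM) x).target :=
  X.smooth_Φ.comp_contMDiffOn (contMDiffOn_extChartAt_symm x)

/-- The right-trivialized derivative of the moment map in the preferred chart at `x`. -/
def momentInChartDeriv (x : M) (y : EM) : EM →L[ℝ] EG :=
  mder EM EG (fun z => momentInChart X x z * (momentInChart X x y)⁻¹) y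

theorem momentInChartDeriv_apply [LieGroup 𝓘(ℝ, EG) ∞ G] {x : M} {y : EM}
    (hy : y ∈ (extChartAt 𝓘(ℝ, EM) x).target) (v : EM) : momentInChartDeriv X x y v =
      momentDeriv X ((extChartAt 𝓘(ℝ, EM) x).symm y)
        (mfderiv 𝓘(ℝ, EM) 𝓘(ℝ, EM) (extChartAt 𝓘(ℝ, EM) x).symm y v) := by
  have hsymm : MDifferentiableAt 𝓘(ℝ, EM) 𝓘(ℝ, EM) (extChartAt 𝓘(ℝ, EM) x).symm y :=
    ((contMDiffOn_extChartAt_symm (n := ∞) x).contMDiffAt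
      ((isOpen_extChartAt_target x).mem_nhds hy)).mdifferentiableAt (by simp)
  have hΦ : MDifferentiable 𝓘(ℝ, EM) 𝓘(ℝ, EG) X.Φ := X.smooth_Φ.mdifferentiable (by simp)
  have h1 := mder_comp (E := EM) (E' := EM) (E'' := EG) (f := (extChartAt 𝓘(ℝ, EM) x).symm)
    (g := X.Φ) rfl (hΦ _) hsymm
  have h2 := mder_comp (E := EM) (E' := EG) (E'' := EG) (f := momentInChart X x) (x := y)
    (g := fun h : G => h * (momentInChart X x y)⁻¹) rfl (mdifferentiable_mul_const _ _)
    ((hΦ _).comp y hsymm)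
  refine (DFunLike.congr_fun h2 v).trans ?_
  have h3 := DFunLike.congr_fun h1 v
  exact congrArg (mder EG EG (fun h : G => h * (momentInChart X x y)⁻¹) (momentInChart X x y)) h3

/-- The map `⋀ 𝔤 → ⋀ EM*` in degree one by which the form `𝒯` is pulled back to the chart. -/
def halfDualInChart (x : M) (y : EM) :
    GroupLieAlgebra 𝓘(ℝ, EG) G →ₗ[ℝ] Module.Dual ℝ EM :=
  HamiltonianPoint.halfDual B.form
    (show EM →ₗ[ℝ] GroupLieAlgebra 𝓘(ℝ, EG) G from (momentInChartDeriv X x y).toLinearMap)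

variable [FiniteDimensional ℝ EM] [LieGroup 𝓘(ℝ, EG) ∞ G]

/-- In a chart, `Γ` is the product of `exp(ω)` and the pull-back of the symbol of the lift. -/
theorem GamTop_inChart {x : M} {y : EM} (hy : y ∈ (extChartAt 𝓘(ℝ, EM) x).target)
    (v : Fin (Module.finrank ℝ EM) → EM) :
    (X.GamTop τ).inChart x y v = formPartLin EM (Module.finrank ℝ EM) v
      (expTwoForm (X.twoForm.inChart x y) * ExteriorAlgebra.map (halfDualInChart X x y)
        (symb B.form (liftElem τ (momentInChart X x y)))) := by
  let m := (extChartAt 𝓘(ℝ, EM) x).symm y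
  let D : EM →L[ℝ] TangentSpace 𝓘(ℝ, EM) m :=
    mfderiv 𝓘(ℝ, EM) 𝓘(ℝ, EM) (extChartAt 𝓘(ℝ, EM) x).symm y
  have h1 : (X.GamTop τ).inChart x y v =
      formPartAlg (Module.finrank ℝ EM) (X.Gam τ m) (fun i => D (v i)) := rfl
  have h2 : D.toLinearMap.dualMap ∘ₗ HamiltonianPoint.halfDual B.form (momentDeriv X m) =
      halfDualInChart X x y := by
    ext ξ w
    have h3 := momentInChartDeriv_apply X hy w
    change HamiltonianPoint.halfDual B.form (momentDeriv X m) ξ (D w) = _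
    rw [HamiltonianPoint.halfDual_apply]
    exact congrArg (fun ζ => (1 / 2 : ℝ) * B.form ξ ζ) h3.symm
  have h4 := formPartAlg_map_dualMap D.toLinearMap (Module.finrank ℝ EM) (X.Gam τ m) v
  rw [h1, formPartLin_apply]
  refine h4.symm.trans ?_
  rw [Gam_eq, map_mul, map_dualMap_expTwoForm D _ rfl, ← AlgHom.comp_apply,
    ExteriorAlgebra.map_comp_map, h2]
  rfl

theorem isSmooth_GamTop [FiniteDimensional ℝ EG] : (X.GamTop τ).IsSmooth := by
  intro x v
  have hopen : IsOpen (extChartAt 𝓘(ℝ, EM) x).target := isOpen_extChartAt_target x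
  refine ContDiffOn.congr (fun y hy => ContDiffAt.contDiffWithinAt ?_)
    fun y hy => GamTop_inChart X τ hy v
  have hmem := hopen.mem_nhds hy
  have hγ := contMDiffOn_momentInChart X x
  have hμ : ContDiffAt ℝ ∞ (momentInChartDeriv X x) y := contDiffAt_mder_mul_inv hopen hγ hy
  have hj : ∀ ξ, FinSmoothAt y (fun z => halfDualInChart X x z ξ) := by
    intro ξ
    refine FinSmoothAt.of_basis (Module.finBasis ℝ EM).dualBasis fun i => ?_
    simp only [Module.Basis.dualBasis_repr]
    let l : EG →L[ℝ] ℝ := LinearMap.toContinuousLinearMap (B.form ξ : EG →ₗ[ℝ] ℝ)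
    have h : ContDiffAt ℝ ∞
        (fun z => (1 / 2 : ℝ) * l (momentInChartDeriv X x z (Module.finBasis ℝ EM i))) y :=
      contDiffAt_const.mul (l.contDiff.contDiffAt.comp y (hμ.clm_apply contDiffAt_const))
    refine h.congr_of_eventuallyEq (Eventually.of_forall fun z => ?_)
    exact HamiltonianPoint.halfDual_apply _ _
  refine FinSmoothAt.contDiffAt (FinSmoothAt.map (FinSmoothAt.mul
    (FinSmoothAt.expTwoForm_of_contDiffAt fun w => ?_) (FinSmoothAt.exteriorAlgebra_map hj
      (finSmoothAt_symb_liftElem τ (hγ.contMDiffAt hmem)))) _)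
  exact (X.smooth_twoForm x w).contDiffAt hmem

end ExteriorForm

theorem mainTheorem1
    {EG : Type*} [NormedAddCommGroup EG] [NormedSpace ℝ EG] [FiniteDimensional ℝ EG]
    {G : Type*} [TopologicalSpace G] [ChartedSpace EG G] [Group G] [LieGroup 𝓘(ℝ, EG) ∞ G]
    [CompactSpace G] [T2Space G]
    {EM : Type*} [NormedAddCommGroup EM] [NormedSpace ℝ EM] [FiniteDimensional ℝ EM]
    {M : Type*} [TopologicalSpace M] [ChartedSpace EM M] [IsManifold 𝓘(ℝ, EM) ∞ M]
    [MulAction G M] [ContMDiffSMul 𝓘(ℝ, EG) 𝓘(ℝ, EM) ∞ G M]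
    (B : InvariantInnerProduct EG G) (τ : B.PinLift) (X : GroupValuedHamiltonian EM M B) :
    (X.GamTop τ).IsVolumeForm ∧
      ∃ ε : G → ℤˣ, ∀ m : M,
        (∀ v : TangentSpace 𝓘(ℝ, EM) m, (∀ w, X.twoForm m ![v, w] = 0) → v = 0) →
          X.GamTop τ m =
            ((ε (X.Φ m) : ℤ) : ℝ) •
              (Real.sqrt |LinearMap.det ((1 / 2 : ℝ) •
                (1 + (adjointAction (EG := EG) (X.Φ m)).toLinearMap))|)⁻¹ • X.expOmegaTop m :=
  ⟨⟨ExteriorForm.isSmooth_GamTop X τ, ExteriorForm.GamTop_ne_zero X τ⟩,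
    ExteriorForm.exists_sign_GamTop X τ⟩

end
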